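/- **Setting.** Let $\mathcal X,\mathcal Y$ be finite-dimensional real normed spaces, with dual norms $\|\cdot\|_*$ and pairing $\langle\cdot,\cdot\rangle$; gradients and $Kx$, $K^Ty$ below are dual vectors. Let $X\subseteq\mathcal X$, $Y\subseteq\mathcal Y$ be closed and convex and $Z=X\times Y$. Let $G$ be convex on $X$, differentiable at each point of $X$, with $G(y)-G(x)-\langle\nabla G(x),y-x\rangle\le\frac{L_G}{2}\|y-x\|^2$ for all $x,y\in X$, where $L_G\ge 0$; let $K$ be linear from $\mathcal X$ to the dual of $\mathcal Y$, with induced norm $L_K=\|K\|$ and transpose $K^T$; let $J:Y\to\mathbb R$ be convex and lower semicontinuous. For $\tilde z=(\tilde x,\tilde y),\ z=(x,y)\in Z$ let $$Q(\tilde z,z)=[G(\tilde x)+\langle K\tilde x,y\rangle-J(y)]-[G(x)+\langle Kx,\tilde y\rangle-J(\tilde y)],\qquad g(\tilde z)=\max_{z\in Z}Q(\tilde z,z).$$ Let $d_X$ (resp. $d_Y$) be differentiable at each point of $X$ (resp. $Y$) and strongly convex there with parameter $\alpha_X>0$ (resp. $\alpha_Y>0$), and $V_X(x,u)=d_X(x)-d_X(u)-\langle\nabla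 d_X(u),x-u\rangle$, similarly $V_Y$. Assume that for some $\Omega_X,\Omega_Y>0$ $$\sup_{x_1,x_2\in X}V_X(x_1,x_2)\le\Omega_X^2,\qquad \sup_{y_1,y_2\in Y}V_Y(y_1,y_2)\le\Omega_Y^2 .$$ **Parameters.** Let $\eta_t,\tau_t>0$ for $t\ge1$, and, for some $p,q\in(0,1)$, $$\beta_1=1,\quad \beta_{t+1}-1=\beta_t\theta_{t+1}\ (t\ge1),\quad 0<\theta_t\le\min\Big\{\frac{\eta_{t-1}}{\eta_t},\frac{\tau_{t-1}}{\tau_t}\Big\}\ (t\ge2),\quad \frac{q\alpha_X}{\eta_t}-\frac{L_G}{\beta_t}-\frac{L_K^2\tau_t}{p\alpha_Y}\ge0\ (t\ge1).$$ Let $\gamma_1=1$ and $\gamma_t=\theta_t^{-1}\gamma_{t-1}$ for $t\ge2$. **Oracle.** Let $\xi_1,\xi_2,\dots$ be i.i.d. random variables, and let $\hat{\mathcal G}(x,\xi)$, $\hat{\mathcal K}_x(x,\xi)$, $\hat{\mathcal K}_y(y,\xi)$ be jointly measurable and unbiased estimators of $\nabla G(x)$ for $x\in X$, of $Kx$ for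 $x\in X'$, and of $K^Ty$ for $y\in Y$, where $X'=\{u+\theta_t(u-v):u,v\in X,\ t\ge2\}$ contains the extrapolated points $\bar x_t$ below. Let $\sigma_{x,G},\sigma_y,\sigma_{x,K}\ge0$ and $\sigma_x=\sqrt{\sigma_{x,G}^2+\sigma_{x,K}^2}$. Consider the assumptions, each required for all such $x$ or $y$: * **A1**: $\mathbb E\|\hat{\mathcal G}(x,\xi)-\nabla G(x)\|_*^2\le\sigma_{x,G}^2$, $\ \mathbb E\|\hat{\mathcal K}_x(x,\xi)-Kx\|_*^2\le\sigma_y^2$, $\ \mathbb E\|\hat{\mathcal K}_y(y,\xi)-K^Ty\|_*^2\le\sigma_{x,K}^2$. * **A2**: $\mathbb E\exp\{\|\hat{\mathcal G}(x,\xi)-\nabla G(x)\|_*^2/\sigma_{x,G}^2\}\le e$, $\ \mathbb E\exp\{\|\hat{\mathcal K}_x(x,\xi)-Kx\|_*^2/\sigma_y^2\}\le e$, $\ \mathbb E\exp\{\|\hat{\mathcal K}_y(y,\xi)-K^Ty\|_*^2/\sigma_{x,K}^2\}\le e$ (where a zero $\sigma$ means that the corresponding error vanishes almost surely). **Stochastic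 APD method.** Given $x_1\in X$, $y_1\in Y$, put $x_1^{ag}=\bar x_1=x_1$, $y_1^{ag}=y_1$ and, for $t\ge1$, $$\begin{aligned} x_t^{md}&=(1-\beta_t^{-1})x_t^{ag}+\beta_t^{-1}x_t,\\ y_{t+1}&=\operatorname{argmin}_{y\in Y}\ \langle-\hat{\mathcal K}_x(\bar x_t,\xi_{2t-1}),y\rangle+J(y)+\tfrac1{\tau_t}V_Y(y,y_t),\\ x_{t+1}&=\operatorname{argmin}_{x\in X}\ \langle\hat{\mathcal G}(x_t^{md},\xi_{2t-1}),x\rangle+\langle x,\hat{\mathcal K}_y(y_{t+1},\xi_{2t})\rangle+\tfrac1{\eta_t}V_X(x,x_t),\\ x_{t+1}^{ag}&=(1-\beta_t^{-1})x_t^{ag}+\beta_t^{-1}x_{t+1},\qquad y_{t+1}^{ag}=(1-\beta_t^{-1})y_t^{ag}+\beta_t^{-1}y_{t+1},\\ \bar x_{t+1}&=\theta_{t+1}(x_{t+1}-x_t)+x_{t+1}. \end{aligned}$$ Write $z_t^{ag}=(x_t^{ag},y_t^{ag})$. **Theorem.** The maximum defining $g(\tilde z)$ is attained for every $\tilde z\in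 Z$, and: (a) Under A1, for all $t\ge1$, $g(z_{t+1}^{ag})$ is integrable and $\mathbb E[g(z_{t+1}^{ag})]\le\mathcal Q_0(t)$, where $$\mathcal Q_0(t)=\frac1{\beta_t\gamma_t}\Big\{\frac{2\gamma_t}{\eta_t}\Omega_X^2+\frac{2\gamma_t}{\tau_t}\Omega_Y^2\Big\}+\frac1{2\beta_t\gamma_t}\sum_{i=1}^t\Big\{\frac{(2-q)\eta_i\gamma_i}{(1-q)\alpha_X}\sigma_x^2+\frac{(2-p)\tau_i\gamma_i}{(1-p)\alpha_Y}\sigma_y^2\Big\}.$$ (b) Under A2, for all $\lambda>0$ and $t\ge1$, $$\operatorname{Prob}\{g(z_{t+1}^{ag})>\mathcal Q_0(t)+\lambda\mathcal Q_1(t)\}\le3\exp\{-\lambda^2/3\}+3\exp\{-\lambda\},$$ where $$\mathcal Q_1(t)=\frac1{\beta_t\gamma_t}\Big(\frac{\sqrt2\,\sigma_x\Omega_X}{\sqrt{\alpha_X}}+\frac{\sigma_y\Omega_Y}{\sqrt{\alpha_Y}}\Big)\sqrt{2\sum_{i=1}^t\gamma_i^2}+\frac1{2\beta_t\gamma_t}\sum_{i=1}^t\Big\{\frac{(2-q)\eta_i\gamma_i}{(1-q)\alpha_X}\sigma_x^2+\frac{(2-p)\tau_i\gamma_i}{(1-p)\alpha_Y}\sigma_y^2\Big\}.$$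 -/

import Mathlib

open MeasureTheory ProbabilityTheory

noncomputable section

/-- The Bregman divergence `V(x, u) = d(x) - d(u) - ⟨∇d(u), x - u⟩`. Gradients are elements of the
dual space, so `⟨·, ·⟩` is the duality pairing and the operator norm on the dual space is the
dual norm. -/
def bregman {E : Type*} [NormedAddCommGroup E] [NormedSpace ℝ E]
    (d : E → ℝ) (x u : E) : ℝ :=
  d x - d u - fderiv ℝ d u (x - u)

/-- `d` has a gradient at every point of `X` and is strongly convex on `X` with parameter `α > 0`
with respect to the norm of the space. -/
def IsDistanceGenerating {E : Type*} [NormedAddCommGroup E] [NormedSpace ℝ E]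
    (X : Set E) (α : ℝ) (d : E → ℝ) : Prop :=
  0 < α ∧ (∀ u ∈ X, DifferentiableAt ℝ d u) ∧ StrongConvexOn X α d

/-- `G` is a smooth convex function on `X`, with the quadratic upper bound with constant `L`. -/
def IsSmoothConvex {E : Type*} [NormedAddCommGroup E] [NormedSpace ℝ E]
    (X : Set E) (L : ℝ) (G : E → ℝ) : Prop :=
  0 ≤ L ∧ ConvexOn ℝ X G ∧ (∀ x ∈ X, DifferentiableAt ℝ G x) ∧
    ∀ x ∈ X, ∀ y ∈ X, G y - G x - fderiv ℝ G x (y - x) ≤ L / 2 * ‖y - x‖ ^ 2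

/-- `Q(z', z) = [G(x') + ⟨K x', y⟩ - J(y)] - [G(x) + ⟨K x, y'⟩ - J(y')]`. The linear operator `K`
takes values in the dual of the `y`-space: `K x y` is `⟨K x, y⟩`, and `‖K‖` is the norm induced by
the given norm on `E` and the dual norm. The transpose of `K` is `K.flip`. -/
def saddleQ {E F : Type*} [NormedAddCommGroup E] [NormedSpace ℝ E]
    [NormedAddCommGroup F] [NormedSpace ℝ F]
    (G : E → ℝ) (K : E →L[ℝ] StrongDual ℝ F) (J : F → ℝ) (z' z : E × F) : ℝ :=
  (G z'.1 + K z'.1 z.2 - J z.2) - (G z.1 + K z.1 z'.2 - J z'.2)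

/-- The gap function `g(z') = max {Q(z', z) : z ∈ X × Y}`. -/
def gap {E F : Type*} [NormedAddCommGroup E] [NormedSpace ℝ E]
    [NormedAddCommGroup F] [NormedSpace ℝ F]
    (X : Set E) (Y : Set F) (G : E → ℝ) (K : E →L[ℝ] StrongDual ℝ F) (J : F → ℝ)
    (z' : E × F) : ℝ :=
  sSup (saddleQ G K J z' '' (X ×ˢ Y))

/-- A stochastic first-order oracle: the estimators of `∇G(x)`, of `K x` and of `Kᵀ y`, as
measurable functions of the query point and of a random sample in `Ξ`. -/
structure StochasticOracle (E F Ξ : Type*) [NormedAddCommGroup E] [NormedSpace ℝ E]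
    [MeasurableSpace E] [NormedAddCommGroup F] [NormedSpace ℝ F] [MeasurableSpace F]
    [MeasurableSpace Ξ] where
  estG : E → Ξ → StrongDual ℝ E
  estKx : E → Ξ → StrongDual ℝ F
  estKy : F → Ξ → StrongDual ℝ E
  measurable_estG : Measurable (Function.uncurry estG)
  measurable_estKx : Measurable (Function.uncurry estKx)
  measurable_estKy : Measurable (Function.uncurry estKy)

/-- The points at which the method may query the estimator of `K x`: the extrapolated points
`u + θ_t (u - v)` with `u, v ∈ X` and `t ≥ 2`. They include all points of `X`, but need not
lie in `X`. -/
def extrapolated {E : Type*} [NormedAddCommGroup E] [NormedSpace ℝ E]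
    (X : Set E) (θ : ℕ → ℝ) : Set E :=
  {w | ∃ t : ℕ, 2 ≤ t ∧ ∃ u ∈ X, ∃ v ∈ X, w = θ t • (u - v) + u}

section Assumptions

variable {E F Ξ : Type*} [NormedAddCommGroup E] [NormedSpace ℝ E] [MeasurableSpace E]
  [NormedAddCommGroup F] [NormedSpace ℝ F] [MeasurableSpace F] [MeasurableSpace Ξ]

/-- The random vector `Z` on `(Ξ, ν)` has mean `m`. -/
def HasMean {W : Type*} [NormedAddCommGroup W] [NormedSpace ℝ W]
    (ν : Measure Ξ) (Z : Ξ → W) (m : W) : Prop :=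
  Integrable Z ν ∧ ∫ s, Z s ∂ν = m

/-- `E[‖Z - m‖²] ≤ σ²`. -/
def HasVarianceLE {W : Type*} [NormedAddCommGroup W] [NormedSpace ℝ W]
    (ν : Measure Ξ) (Z : Ξ → W) (m : W) (σ : ℝ) : Prop :=
  Integrable (fun s => ‖Z s - m‖ ^ 2) ν ∧ ∫ s, ‖Z s - m‖ ^ 2 ∂ν ≤ σ ^ 2

/-- `E[exp(‖Z - m‖² / σ²)] ≤ exp 1`; for `σ = 0` this means, by the convention `c / 0 = ∞` for
`c > 0` and `0 / 0 = 0`, that `Z = m` almost surely. -/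
def HasLightTail {W : Type*} [NormedAddCommGroup W] [NormedSpace ℝ W]
    (ν : Measure Ξ) (Z : Ξ → W) (m : W) (σ : ℝ) : Prop :=
  (σ = 0 → ∀ᵐ s ∂ν, Z s = m) ∧
    Integrable (fun s => Real.exp (‖Z s - m‖ ^ 2 / σ ^ 2)) ν ∧
    ∫ s, Real.exp (‖Z s - m‖ ^ 2 / σ ^ 2) ∂ν ≤ Real.exp 1

/-- The oracle is unbiased. -/
def StochasticOracle.Unbiased (O : StochasticOracle E F Ξ) (ν : Measure Ξ) (X : Set E) (Y : Set F)
    (θ : ℕ → ℝ) (G : E → ℝ) (K : E →L[ℝ] StrongDual ℝ F) : Prop :=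
  (∀ x ∈ X, HasMean ν (O.estG x) (fderiv ℝ G x)) ∧
  (∀ x ∈ extrapolated X θ, HasMean ν (O.estKx x) (K x)) ∧
  (∀ y ∈ Y, HasMean ν (O.estKy y) (K.flip y))

/-- The bounded variance assumption A1. -/
def StochasticOracle.BoundedVariance (O : StochasticOracle E F Ξ) (ν : Measure Ξ) (X : Set E)
    (Y : Set F) (θ : ℕ → ℝ) (G : E → ℝ) (K : E →L[ℝ] StrongDual ℝ F)
    (σxG σy σxK : ℝ) : Prop :=
  (∀ x ∈ X, HasVarianceLE ν (O.estG x) (fderiv ℝ G x) σxG) ∧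
  (∀ x ∈ extrapolated X θ, HasVarianceLE ν (O.estKx x) (K x) σy) ∧
  (∀ y ∈ Y, HasVarianceLE ν (O.estKy y) (K.flip y) σxK)

/-- The light-tail assumption A2. -/
def StochasticOracle.LightTail (O : StochasticOracle E F Ξ) (ν : Measure Ξ) (X : Set E)
    (Y : Set F) (θ : ℕ → ℝ) (G : E → ℝ) (K : E →L[ℝ] StrongDual ℝ F)
    (σxG σy σxK : ℝ) : Prop :=
  (∀ x ∈ X, HasLightTail ν (O.estG x) (fderiv ℝ G x) σxG) ∧
  (∀ x ∈ extrapolated X θ, HasLightTail ν (O.estKx x) (K x) σy) ∧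
  (∀ y ∈ Y, HasLightTail ν (O.estKy y) (K.flip y) σxK)

/-- A run of the stochastic accelerated primal-dual method, started at `(x₁, y₁)`, on the sequence
of oracle samples `s`. Iteration `t ≥ 1` uses the sample `s (2t - 1)` for the estimators at
`xbar t` and `xmd t`, which are known at the start of the iteration, and the fresh sample `s (2t)`
for the estimator at `y (t + 1)`, which depends on the first sample. -/
structure IsStochasticAPDRun (O : StochasticOracle E F Ξ) (X : Set E) (Y : Set F) (J : F → ℝ)
    (dX : E → ℝ) (dY : F → ℝ) (β θ η τ : ℕ → ℝ) (x₁ : E) (y₁ : F) (s : ℕ → Ξ)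
    (x xbar xmd xag : ℕ → E) (y yag : ℕ → F) : Prop where
  x_one : x 1 = x₁
  y_one : y 1 = y₁
  xag_one : xag 1 = x₁
  yag_one : yag 1 = y₁
  xbar_one : xbar 1 = x₁
  xmd_eq : ∀ t, 1 ≤ t → xmd t = (1 - (β t)⁻¹) • xag t + (β t)⁻¹ • x t
  y_mem : ∀ t, 1 ≤ t → y (t + 1) ∈ Y
  y_argmin : ∀ t, 1 ≤ t →
    IsMinOn (fun v => -(O.estKx (xbar t) (s (2 * t - 1)) v) + J v
      + 1 / τ t * bregman dY v (y t)) Y (y (t + 1))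
  x_mem : ∀ t, 1 ≤ t → x (t + 1) ∈ X
  x_argmin : ∀ t, 1 ≤ t →
    IsMinOn (fun u => O.estG (xmd t) (s (2 * t - 1)) u + O.estKy (y (t + 1)) (s (2 * t)) u
      + 1 / η t * bregman dX u (x t)) X (x (t + 1))
  xag_eq : ∀ t, 1 ≤ t → xag (t + 1) = (1 - (β t)⁻¹) • xag t + (β t)⁻¹ • x (t + 1)
  yag_eq : ∀ t, 1 ≤ t → yag (t + 1) = (1 - (β t)⁻¹) • yag t + (β t)⁻¹ • y (t + 1)
  xbar_eq : ∀ t, 1 ≤ t → xbar (t + 1) = θ (t + 1) • (x (t + 1) - x t) + x (t + 1)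

end Assumptions

/-- `γ₁ = 1` and `γ_t = θ_t⁻¹ γ_{t-1}` for `t ≥ 2`; the value at `0` is never used. -/
def gammaSeq (θ : ℕ → ℝ) : ℕ → ℝ
  | 0 => 1
  | 1 => 1
  | (n + 2) => (θ (n + 2))⁻¹ * gammaSeq θ (n + 1)

/-- `(1 / (2 β_t γ_t)) ∑_{i=1}^t {(2-q) η_i γ_i σ_x² / ((1-q) α_X)
+ (2-p) τ_i γ_i σ_y² / ((1-p) α_Y)}`. -/
def varianceSum (β θ η τ : ℕ → ℝ) (p q αX αY σx σy : ℝ) (t : ℕ) : ℝ :=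
  1 / (2 * β t * gammaSeq θ t) * ∑ i ∈ Finset.Icc 1 t,
    ((2 - q) * η i * gammaSeq θ i / ((1 - q) * αX) * σx ^ 2
      + (2 - p) * τ i * gammaSeq θ i / ((1 - p) * αY) * σy ^ 2)

/-- The quantity `Q₀(t)`. -/
def boundQ0 (β θ η τ : ℕ → ℝ) (p q αX αY ΩX ΩY σx σy : ℝ) (t : ℕ) : ℝ :=
  1 / (β t * gammaSeq θ t) *
      (2 * gammaSeq θ t / η t * ΩX ^ 2 + 2 * gammaSeq θ t / τ t * ΩY ^ 2)
    + varianceSum β θ η τ p q αX αY σx σy t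

/-- The quantity `Q₁(t)`. -/
def boundQ1 (β θ η τ : ℕ → ℝ) (p q αX αY ΩX ΩY σx σy : ℝ) (t : ℕ) : ℝ :=
  1 / (β t * gammaSeq θ t) *
      (Real.sqrt 2 * σx * ΩX / Real.sqrt αX + σy * ΩY / Real.sqrt αY) *
      Real.sqrt (2 * ∑ i ∈ Finset.Icc 1 t, gammaSeq θ i ^ 2)
    + varianceSum β θ η τ p q αX αY σx σy t

end

/-! Fix a comparison point `(u, v)` of `X ×ˢ Y`. One iteration obeys the deterministic accelerated
primal-dual inequality (`IsStochasticAPDRun.one_step`) up to the oracle errors: A_t for ∇G, e_t for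
Kx (both from sample 2t-1) and B_t for Kᵀy (from sample 2t). Multiplied by γ_t, these inequalities
telescope (`weighted_telescope`): the recursion for β matches consecutive values of Q, the
extrapolated point makes the bilinear terms cancel up to a product of increments, and Young's
inequality with the step-size condition absorbs that product.

The errors enter paired with vectors that involve `(u, v)`, yet the maximum over `(u, v)` is taken
before the expectation. Shadow sequences resolve this: mirror descent along minus the gradient
errors has a regret bound that replaces the comparison point by a shadow iterate, at the price of a
second Bregman term (hence 2Ω²) and squared error norms. The remaining `noise` is free of `(u, v)`:
squared error norms, plus errors applied to vectors already known when the sample is drawn.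

The primal errors A_t and B_t come from successive samples, and a dual norm offers no orthogonality;
Young's inequality for A_t + B_t would lose a factor 2. Instead the shadow makes one mirror step per
error, and an auxiliary prox point, computed from A_t alone, takes the place of the new iterate in
the pairing with B_t. This leaves ‖A_t‖² + ‖B_t‖², whose mean is at most σ_x².

For (a), the pairings have mean zero. For (b), the three sums of pairings are bounded by Chernoff's
method, from the moment bound exp(3c²/4) of `lintegral_exp_le_of_exp_sq`, and the three sums of
squared norms by Jensen and Markov (`measure_weighted_sum_gt_le`); a union bound over six events
concludes. Measurability of all sequences rests on `IsDistanceGenerating.exists_measurable_prox`. -/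

section ConvexAnalysis

/-! ### Convexity along segments, Bregman divergences and prox inequalities. -/

variable {E : Type*} [NormedAddCommGroup E] [NormedSpace ℝ E]

/-- The one-sided derivative at the end of a segment; the term `t * b` disappears in the limit. Only
points of the segment enter, so it applies to functions controlled on a convex set alone. -/
theorem fderiv_le_of_forall_segment {f : E → ℝ} {u w : E} (hf : DifferentiableAt ℝ f u) {a b : ℝ}
    (h : ∀ t : ℝ, 0 < t → t ≤ 1 → f (u + t • w) - f u ≤ t * (a + t * b)) :
    fderiv ℝ f u w ≤ a := by
  have hd : HasDerivAt (fun t : ℝ => f (u + t • w)) (fderiv ℝ f u w) 0 := by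
    have h1 : HasDerivAt (fun t : ℝ => u + t • w) w 0 := by
      simpa using ((hasDerivAt_id (0 : ℝ)).smul_const w).const_add u
    have h2 : HasFDerivAt f (fderiv ℝ f u) (u + (0 : ℝ) • w) := by
      simpa using hf.hasFDerivAt
    exact h2.comp_hasDerivAt 0 h1
  have hlim := hd.tendsto_slope_zero_right
  have hlim' : Filter.Tendsto (fun t : ℝ => a + t * b) (nhdsWithin 0 (Set.Ioi 0)) (nhds a) := by
    have : Filter.Tendsto (fun t : ℝ => a + t * b) (nhds 0) (nhds (a + 0 * b)) := by
      apply Continuous.tendsto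
      fun_prop
    simpa using this.mono_left nhdsWithin_le_nhds
  refine le_of_tendsto_of_tendsto hlim hlim' ?_
  filter_upwards [Ioc_mem_nhdsGT (zero_lt_one' ℝ)] with t ht
  have := h t ht.1 ht.2
  simp only [zero_add, zero_smul, add_zero, smul_eq_mul]
  rw [inv_mul_le_iff₀ ht.1]
  exact this

theorem ConvexOn.segment_le {X : Set E} {f : E → ℝ} (hf : ConvexOn ℝ X f) {u v : E} (hu : u ∈ X)
    (hv : v ∈ X) {t : ℝ} (h0 : 0 ≤ t) (h1 : t ≤ 1) :
    f (u + t • (v - u)) ≤ f u + t * (f v - f u) := by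
  have h := hf.2 hu hv (sub_nonneg.2 h1) h0 (by ring)
  have e : (1 - t) • u + t • v = u + t • (v - u) := by module
  rw [e] at h
  simp only [smul_eq_mul] at h
  linarith

theorem Convex.segment_mem {X : Set E} (hX : Convex ℝ X) {u v : E} (hu : u ∈ X)
    (hv : v ∈ X) {t : ℝ} (h0 : 0 ≤ t) (h1 : t ≤ 1) : u + t • (v - u) ∈ X :=
  hX.add_smul_sub_mem hu hv ⟨h0, h1⟩

theorem ConvexOn.add_fderiv_le {X : Set E} {f : E → ℝ} (hf : ConvexOn ℝ X f) {u v : E}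
    (hu : u ∈ X) (hv : v ∈ X) (hd : DifferentiableAt ℝ f u) :
    f u + fderiv ℝ f u (v - u) ≤ f v := by
  have := fderiv_le_of_forall_segment (w := v - u) (a := f v - f u) (b := 0) hd
    fun t h0 h1 => by linarith [hf.segment_le hu hv h0.le h1]
  linarith

namespace IsDistanceGenerating

variable {X : Set E} {α : ℝ} {d : E → ℝ}

theorem convex (hd : IsDistanceGenerating X α d) : Convex ℝ X := hd.2.2.1

theorem continuousOn (hd : IsDistanceGenerating X α d) : ContinuousOn d X :=
  fun u hu => (hd.2.1 u hu).continuousAt.continuousWithinAt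

theorem le_bregman (hd : IsDistanceGenerating X α d) {u v : E} (hu : u ∈ X) (hv : v ∈ X) :
    α / 2 * ‖v - u‖ ^ 2 ≤ bregman d v u := by
  have := fderiv_le_of_forall_segment (w := v - u) (a := d v - d u - α / 2 * ‖v - u‖ ^ 2)
    (b := α / 2 * ‖v - u‖ ^ 2) (hd.2.1 u hu) fun t h0 h1 => by
      have h := hd.2.2.2 hu hv (sub_nonneg.2 h1) h0.le (by ring)
      have e : (1 - t) • u + t • v = u + t • (v - u) := by module
      rw [e, norm_sub_rev] at h
      simp only [smul_eq_mul] at h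
      linarith
  unfold bregman
  linarith

theorem bregman_nonneg (hd : IsDistanceGenerating X α d) {u v : E} (hu : u ∈ X) (hv : v ∈ X) :
    0 ≤ bregman d v u :=
  le_trans (mul_nonneg (by linarith [hd.1]) (sq_nonneg _)) (hd.le_bregman hu hv)

theorem norm_sub_le (hd : IsDistanceGenerating X α d) {R : ℝ} (hR : 0 < R)
    (hV : ∀ x₁ ∈ X, ∀ x₂ ∈ X, bregman d x₁ x₂ ≤ R ^ 2) {u v : E} (hu : u ∈ X) (hv : v ∈ X) :
    ‖u - v‖ ≤ R * Real.sqrt (2 / α) := by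
  have hα := hd.1
  have h := (hd.le_bregman hv hu).trans (hV u hu v hv)
  have h2 : ‖u - v‖ ^ 2 ≤ R ^ 2 * (2 / α) := by
    rw [mul_div_assoc', le_div_iff₀ hα]
    linarith
  have h3 : (R * Real.sqrt (2 / α)) ^ 2 = R ^ 2 * (2 / α) := by
    rw [mul_pow, Real.sq_sqrt (by positivity)]
  exact abs_le_of_sq_le_sq' (by rw [h3]; exact h2) (by positivity) |>.2

theorem isCompact [FiniteDimensional ℝ E] (hd : IsDistanceGenerating X α d) (hX : IsClosed X)
    {R : ℝ} (hR : 0 < R) (hV : ∀ x₁ ∈ X, ∀ x₂ ∈ X, bregman d x₁ x₂ ≤ R ^ 2) : IsCompact X := by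
  have := FiniteDimensional.proper_real E
  refine Metric.isCompact_of_isClosed_isBounded hX (Metric.isBounded_iff.2
    ⟨R * Real.sqrt (2 / α), fun u hu v hv => ?_⟩)
  rw [dist_eq_norm]
  exact hd.norm_sub_le hR hV hu hv

/-- The three-point inequality. Since `φ` need not be differentiable, minimality is compared along
the segment from `w` to `v`, where convexity bounds `φ` linearly, and the derivative is taken of
`-(b * d)` only. -/
theorem le_of_isMinOn (hd : IsDistanceGenerating X α d) {φ : E → ℝ} (hφ : ConvexOn ℝ X φ) {b : ℝ}
    {u w v : E} (hw : w ∈ X)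
    (hmin : IsMinOn (fun v => φ v + b * bregman d v u) X w) (hv : v ∈ X) :
    φ w ≤ φ v + b * (bregman d v u - bregman d v w - bregman d w u) := by
  have key := fderiv_le_of_forall_segment (f := fun x => -(b * d x)) (u := w) (w := v - w)
    (a := φ v - φ w - b * fderiv ℝ d u (v - w)) (b := 0) ((hd.2.1 w hw).const_mul b).neg
    fun t h0 h1 => by
      have h2 := hmin (hd.convex.segment_mem hw hv h0.le h1)
      have h3 := hφ.segment_le hw hv h0.le h1
      simp only [Set.mem_ofPred_eq, bregman] at h2
      have h4 : fderiv ℝ d u (w + t • (v - w) - u)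
          = fderiv ℝ d u (w - u) + t * fderiv ℝ d u (v - w) := by
        rw [show w + t • (v - w) - u = (w - u) + t • (v - w) by module, map_add, map_smul,
          smul_eq_mul]
      rw [h4] at h2
      linarith
  have h5 : fderiv ℝ (fun x => -(b * d x)) w (v - w) = -(b * fderiv ℝ d w (v - w)) := by
    rw [fderiv_fun_neg, fderiv_const_mul (hd.2.1 w hw)]
    simp
  rw [h5] at key
  have h6 : fderiv ℝ d u (v - u) = fderiv ℝ d u (v - w) + fderiv ℝ d u (w - u) := by
    rw [← map_add]
    congr 1
    abel
  unfold bregman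
  rw [h6]
  linarith

theorem linear_le_of_isMinOn (hd : IsDistanceGenerating X α d) (s : StrongDual ℝ E) {b : ℝ}
    {u w v : E} (hw : w ∈ X)
    (hmin : IsMinOn (fun v => s v + b * bregman d v u) X w) (hv : v ∈ X) :
    s w ≤ s v + b * (bregman d v u - bregman d v w - bregman d w u) :=
  hd.le_of_isMinOn (s.toLinearMap.convexOn hd.convex) hw hmin hv

end IsDistanceGenerating

theorem StrongDual.apply_le_sq_add_sq (s : StrongDual ℝ E) (v : E) {a : ℝ} (ha : 0 < a) :
    s v ≤ ‖s‖ ^ 2 / (2 * a) + a / 2 * ‖v‖ ^ 2 := by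
  have h1 : s v ≤ ‖s‖ * ‖v‖ := (le_abs_self _).trans (s.le_opNorm v)
  have h2 : ‖s‖ ^ 2 / (2 * a) + a / 2 * ‖v‖ ^ 2 - ‖s‖ * ‖v‖ = (‖s‖ - a * ‖v‖) ^ 2 / (2 * a) := by
    field_simp
    ring
  have h3 : 0 ≤ (‖s‖ - a * ‖v‖) ^ 2 / (2 * a) := by positivity
  linarith

namespace IsDistanceGenerating

variable {X : Set E} {α : ℝ} {d : E → ℝ}

/-- The regret bound of one mirror descent step. -/
theorem mirror_step (hd : IsDistanceGenerating X α d) (s : StrongDual ℝ E) {b : ℝ}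
    (hb : 0 < b) {u w v : E} (hu : u ∈ X) (hw : w ∈ X)
    (hmin : IsMinOn (fun v => s v + b * bregman d v u) X w) (hv : v ∈ X) :
    s (u - v) ≤ b * (bregman d v u - bregman d v w) + ‖s‖ ^ 2 / (2 * (b * α)) := by
  have h1 := hd.linear_le_of_isMinOn s hw hmin hv
  have h2 := StrongDual.apply_le_sq_add_sq s (u - w) (mul_pos hb hd.1)
  have h3 := mul_le_mul_of_nonneg_left (hd.le_bregman hu hw) hb.le
  rw [norm_sub_rev] at h2
  simp only [map_sub] at *
  linarith

/-- Two errors that arrive one after the other contribute the sum of their squared norms, up to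
a term which is linear in the second one. -/
theorem neg_sub_bregman_le (hd : IsDistanceGenerating X α d) (s r : StrongDual ℝ E) {b : ℝ}
    (hb : 0 < b) {u w v : E} (hu : u ∈ X) (hw : w ∈ X)
    (hmin : IsMinOn (fun v => s v + b * bregman d v u) X w) (hv : v ∈ X) :
    -(s + r) (v - u) - b * bregman d v u
      ≤ ‖s‖ ^ 2 / (2 * (b * α)) + ‖r‖ ^ 2 / (2 * (b * α)) - r (w - u) := by
  -- The three-point inequality splits the Bregman term of `v` from `u` into one of `w` from `u`,
  -- which absorbs `s`, and one of `v` from `w`, which absorbs `r`.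
  have h1 := hd.linear_le_of_isMinOn s hw hmin hv
  have h2 := StrongDual.apply_le_sq_add_sq s (u - w) (mul_pos hb hd.1)
  have h3 := mul_le_mul_of_nonneg_left (hd.le_bregman hu hw) hb.le
  have h4 := StrongDual.apply_le_sq_add_sq r (w - v) (mul_pos hb hd.1)
  have h5 := mul_le_mul_of_nonneg_left (hd.le_bregman hw hv) hb.le
  rw [norm_sub_rev] at h2 h4
  simp only [map_sub, add_apply] at *
  linarith

/-- Adding the two three-point inequalities cancels `φ` and the terms at the common center `u`,
leaving b α ‖w - v‖² ≤ (r - s)(w - v). The prox map is thus Lipschitz in the dual vector, and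
single-valued when `s = r`. -/
theorem isMinOn_unique (hd : IsDistanceGenerating X α d) {φ : E → ℝ} (hφ : ConvexOn ℝ X φ)
    {s r : StrongDual ℝ E} {b : ℝ} (hb : 0 < b) {u w v : E} (hw : w ∈ X) (hv : v ∈ X)
    (hwmin : IsMinOn (fun v => φ v + s v + b * bregman d v u) X w)
    (hvmin : IsMinOn (fun v => φ v + r v + b * bregman d v u) X v) :
    ‖w - v‖ ≤ ‖s - r‖ / (b * α) := by
  have hbα : 0 < b * α := mul_pos hb hd.1
  have h1 := hd.le_of_isMinOn (hφ.add (s.toLinearMap.convexOn hd.convex)) hw hwmin hv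
  have h2 := hd.le_of_isMinOn (hφ.add (r.toLinearMap.convexOn hd.convex)) hv hvmin hw
  have h3 := mul_le_mul_of_nonneg_left (hd.le_bregman hw hv) hb.le
  have h4 := mul_le_mul_of_nonneg_left (hd.le_bregman hv hw) hb.le
  have h5 : (r - s) (w - v) ≤ ‖r - s‖ * ‖w - v‖ := (le_abs_self _).trans ((r - s).le_opNorm _)
  rw [norm_sub_rev] at h3
  rw [norm_sub_rev s r] at *
  simp only [Pi.add_apply, ContinuousLinearMap.coe_coe, map_sub, sub_apply]
    at h1 h2 h5
  rw [le_div_iff₀ hbα]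
  by_contra! hlt
  have hpos : 0 < ‖w - v‖ := by
    rcases (norm_nonneg (w - v)).eq_or_lt with h | h
    · rw [← h] at hlt
      linarith [norm_nonneg (r - s), zero_mul (b * α)]
    · exact h
  have h6 : b * α * ‖w - v‖ ^ 2 ≤ ‖r - s‖ * ‖w - v‖ := by linarith
  have h7 := mul_lt_mul_of_pos_right hlt hpos
  linarith

end IsDistanceGenerating

theorem secondCountable_strongDual [FiniteDimensional ℝ E] :
    SecondCountableTopology (StrongDual ℝ E) := by
  have := FiniteDimensional.proper_real (StrongDual ℝ E)
  infer_instance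

end ConvexAnalysis

/-! ### Measurability of the proximal mapping. -/

section Prox

variable {E : Type*} [NormedAddCommGroup E] [NormedSpace ℝ E] [FiniteDimensional ℝ E]
  [MeasurableSpace E] [BorelSpace E] {X : Set E} {α : ℝ} {d : E → ℝ}

/-- The proximal mapping exists, is unique and is measurable in the dual vector and in the
prox-center, even where `∇d` is discontinuous. -/
theorem IsDistanceGenerating.exists_measurable_prox (hd : IsDistanceGenerating X α d)
    (hX : IsCompact X) (hne : X.Nonempty) {φ : E → ℝ} (hφ : ConvexOn ℝ X φ)
    (hlsc : LowerSemicontinuousOn φ X) {b : ℝ} (hb : 0 < b) :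
    ∃ pr : StrongDual ℝ E × E → E, Measurable pr ∧ ∀ s u, pr (s, u) ∈ X ∧
      IsMinOn (fun v => φ v + s v + b * bregman d v u) X (pr (s, u)) ∧
      ∀ w ∈ X, IsMinOn (fun v => φ v + s v + b * bregman d v u) X w → w = pr (s, u) := by
  have := secondCountable_strongDual (E := E)
  have ⟨u₀, _⟩ := hne
  have hex : ∀ s : StrongDual ℝ E, ∃ w ∈ X,
      IsMinOn (fun v => φ v + s v + b * bregman d v u₀) X w := by
    intro s
    refine LowerSemicontinuousOn.exists_isMinOn hne hX (LowerSemicontinuousOn.add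
      (hlsc.add s.continuous.continuousOn.lowerSemicontinuousOn)
      (ContinuousOn.lowerSemicontinuousOn ?_))
    unfold bregman
    have := hd.continuousOn
    fun_prop
  choose a haX hamin using hex
  have hlip : LipschitzWith (Real.toNNReal (1 / (b * α))) a := by
    refine LipschitzWith.of_dist_le_mul fun s r => ?_
    rw [dist_eq_norm, dist_eq_norm, Real.coe_toNNReal _ (by have := hd.1; positivity),
      one_div_mul_eq_div]
    exact hd.isMinOn_unique hφ hb (haX s) (haX r) (hamin s) (hamin r)
  -- Changing the prox-center adds to the objective only a linear functional and a constant. Every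
  -- prox step thus reduces to one with the fixed center `u₀`, where the solution is Lipschitz in
  -- the dual vector; the center enters only through the Borel function `fderiv ℝ d`.
  have hcongr : ∀ (s : StrongDual ℝ E) (u w : E),
      IsMinOn (fun v => φ v + s v + b * bregman d v u) X w ↔
      IsMinOn (fun v => φ v + (s + b • (fderiv ℝ d u₀ - fderiv ℝ d u)) v
        + b * bregman d v u₀) X w := by
    intro s u w
    have : (fun v => φ v + (s + b • (fderiv ℝ d u₀ - fderiv ℝ d u)) v + b * bregman d v u₀)
        = fun v => (φ v + s v + b * bregman d v u)
          + b * (d u - d u₀ - fderiv ℝ d u u + fderiv ℝ d u₀ u₀) := by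
      funext v
      simp only [bregman, map_sub, add_apply, smul_apply,
        sub_apply, smul_eq_mul]
      ring
    rw [this]
    simp only [isMinOn_iff, add_le_add_iff_right]
  refine ⟨fun z => a (z.1 + b • (fderiv ℝ d u₀ - fderiv ℝ d z.2)), ?_, fun s u => ⟨haX _, ?_, ?_⟩⟩
  · refine hlip.continuous.measurable.comp (measurable_fst.add ?_)
    exact (measurable_const.sub ((measurable_fderiv ℝ d).comp measurable_snd)).const_smul b
  · exact (hcongr s u _).2 (hamin _)
  · intro w hw hwmin
    have h := hd.isMinOn_unique hφ hb hw (haX _) ((hcongr s u w).1 hwmin)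
      (hamin (s + b • (fderiv ℝ d u₀ - fderiv ℝ d u)))
    rw [sub_self, norm_zero, zero_div] at h
    exact sub_eq_zero.1 (norm_le_zero_iff.1 h)

end Prox

/-! ### The deterministic inequalities of one iteration. -/

section Iteration

variable {E F : Type*} [NormedAddCommGroup E] [NormedSpace ℝ E]
  [NormedAddCommGroup F] [NormedSpace ℝ F]

theorem convex_combination_mem {X : Set E} (hX : Convex ℝ X) {β : ℝ} (hβ : 1 ≤ β) {u v : E}
    (hu : u ∈ X) (hv : v ∈ X) : (1 - β⁻¹) • u + β⁻¹ • v ∈ X :=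
  hX hu hv (sub_nonneg.2 (inv_le_one_of_one_le₀ hβ)) (by positivity) (by ring)

/-- The new average differs from the gradient point by β⁻¹(x₁ - x₀), so the quadratic upper bound,
multiplied by β, costs only LG/(2β) times the squared step. Convexity of G at the gradient point is
used towards both `xa` and `x`, with weights β - 1 and 1; the bilinear terms are affine in the
averages. -/
theorem saddleQ_average_le {X : Set E} {Y : Set F} {G : E → ℝ} {LG : ℝ}
    (hG : IsSmoothConvex X LG G) (K : E →L[ℝ] StrongDual ℝ F) {J : F → ℝ} (hJ : ConvexOn ℝ Y J)
    {β : ℝ} (hβ : 1 ≤ β) {x₀ x₁ xa x : E} {y₁ ya y : F} (hx₀ : x₀ ∈ X) (hx₁ : x₁ ∈ X)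
    (hxa : xa ∈ X) (hx : x ∈ X) (hy₁ : y₁ ∈ Y) (hya : ya ∈ Y) :
    β * saddleQ G K J ((1 - β⁻¹) • xa + β⁻¹ • x₁, (1 - β⁻¹) • ya + β⁻¹ • y₁) (x, y)
        - (β - 1) * saddleQ G K J (xa, ya) (x, y)
      ≤ fderiv ℝ G ((1 - β⁻¹) • xa + β⁻¹ • x₀) (x₁ - x) + (J y₁ - J y) + (K x₁ y - K x y₁)
        + LG / (2 * β) * ‖x₁ - x₀‖ ^ 2 := by
  obtain ⟨-, hGc, hGd, hGs⟩ := hG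
  have hβ0 : 0 < β := by linarith
  set xm := (1 - β⁻¹) • xa + β⁻¹ • x₀ with hxm
  have hxmX : xm ∈ X := convex_combination_mem hGc.1 hβ hxa hx₀
  have hx₁X := convex_combination_mem hGc.1 hβ hxa hx₁
  have h1 := hGs xm hxmX _ hx₁X
  have hstep : (1 - β⁻¹) • xa + β⁻¹ • x₁ - xm = β⁻¹ • (x₁ - x₀) := by
    rw [hxm]
    module
  have h2 := hGc.add_fderiv_le hxmX hxa (hGd _ hxmX)
  have h3 := hGc.add_fderiv_le hxmX hx (hGd _ hxmX)
  have h4 : fderiv ℝ G xm ((1 - β⁻¹) • xa + β⁻¹ • x₁ - xm)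
      = (1 - β⁻¹) * fderiv ℝ G xm (xa - xm)
        + β⁻¹ * (fderiv ℝ G xm (x - xm) + fderiv ℝ G xm (x₁ - x)) := by
    rw [← map_add, ← smul_eq_mul, ← smul_eq_mul, ← map_smul, ← map_smul, ← map_add]
    congr 1
    module
  rw [h4, hstep, norm_smul, Real.norm_of_nonneg (by positivity), mul_pow] at h1
  have h5 := hJ.2 hya hy₁ (sub_nonneg.2 (inv_le_one_of_one_le₀ hβ)) (inv_nonneg.2 hβ0.le)
    (by ring)
  simp only [smul_eq_mul] at h5
  simp only [saddleQ, map_add, map_smul, add_apply, smul_apply, smul_eq_mul]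
  have h1' := mul_le_mul_of_nonneg_left h1 hβ0.le
  have h5' := mul_le_mul_of_nonneg_left h5 hβ0.le
  have h2' := mul_le_mul_of_nonneg_left h2 (sub_nonneg.2 hβ)
  have e1 : β * ((1 - β⁻¹) * fderiv ℝ G xm (xa - xm)
        + β⁻¹ * (fderiv ℝ G xm (x - xm) + fderiv ℝ G xm (x₁ - x)))
      = (β - 1) * fderiv ℝ G xm (xa - xm) + fderiv ℝ G xm (x - xm) + fderiv ℝ G xm (x₁ - x) := by
    field_simp
    ring
  have e2 : β * (LG / 2 * (β⁻¹ ^ 2 * ‖x₁ - x₀‖ ^ 2)) = LG / (2 * β) * ‖x₁ - x₀‖ ^ 2 := by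
    field_simp
  have e3 : β * ((1 - β⁻¹) * J ya + β⁻¹ * J y₁) = (β - 1) * J ya + J y₁ := by
    field_simp
  have e4 : β * ((1 - β⁻¹) * K xa y + β⁻¹ * K x₁ y) = (β - 1) * K xa y + K x₁ y := by
    field_simp
  have e5 : β * ((1 - β⁻¹) * K x ya + β⁻¹ * K x y₁) = (β - 1) * K x ya + K x y₁ := by
    field_simp
  linarith

namespace IsDistanceGenerating

variable {X : Set E} {α : ℝ} {d : E → ℝ}

/-- A prox step with a gradient corrupted by two successive errors `A` and `B`. The errors are
compensated by a shadow sequence that performs a mirror step for each of them. -/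
theorem linear_prox_step_le (hd : IsDistanceGenerating X α d) (g A B : StrongDual ℝ E) {b q : ℝ}
    (hb : 0 < b) (hq : q ∈ Set.Ioo (0 : ℝ) 1) {x₀ x₁ xh xv xw xv₁ x : E} (hx₀ : x₀ ∈ X)
    (hx₁ : x₁ ∈ X) (hxh : xh ∈ X) (hxv : xv ∈ X) (hxw : xw ∈ X) (hxv₁ : xv₁ ∈ X) (hx : x ∈ X)
    (hmin₁ : IsMinOn (fun v => (g + A + B) v + b * bregman d v x₀) X x₁)
    (hminh : IsMinOn (fun v => A v + (1 - q) * b * bregman d v x₀) X xh)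
    (hminw : IsMinOn (fun v => (-A) v + b * bregman d v xv) X xw)
    (hminv : IsMinOn (fun v => (-B) v + b * bregman d v xw) X xv₁) :
    g (x₁ - x) ≤ b * (bregman d x x₀ - bregman d x x₁) + b * (bregman d x xv - bregman d x xv₁)
      - q * b * α / 2 * ‖x₁ - x₀‖ ^ 2
      + (2 - q) / (2 * ((1 - q) * b * α)) * (‖A‖ ^ 2 + ‖B‖ ^ 2)
      + A (xv - x₀) + B (xw - xh) := by
  have hα := hd.1
  have hq1 : 0 < 1 - q := by linarith [hq.2]
  have h1 := hd.linear_le_of_isMinOn _ hx₁ hmin₁ hx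
  -- The Bregman distance from `x₀` to `x₁` is divided: the fraction 1 - q pays for the errors, the
  -- fraction q becomes the negative quadratic term.
  have h2 := hd.neg_sub_bregman_le A B (mul_pos hq1 hb) hx₀ hxh hminh hx₁
  have h3 := hd.mirror_step _ hb hxv hxw hminw hx
  have h4 := hd.mirror_step _ hb hxw hxv₁ hminv hx
  have h5 := mul_le_mul_of_nonneg_left (hd.le_bregman hx₀ hx₁) (mul_pos hq.1 hb).le
  -- Each error is paid for twice, in the prox step with 1/(1-q) and in the shadow step with 1; the
  -- sum is (2-q)/(1-q).
  have e : (2 - q) / (2 * ((1 - q) * b * α)) * (‖A‖ ^ 2 + ‖B‖ ^ 2)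
      = ‖A‖ ^ 2 / (2 * ((1 - q) * b * α)) + ‖B‖ ^ 2 / (2 * ((1 - q) * b * α))
        + ‖A‖ ^ 2 / (2 * (b * α)) + ‖B‖ ^ 2 / (2 * (b * α)) := by
    field_simp
    ring
  rw [e]
  simp only [map_sub, add_apply, neg_apply, norm_neg] at *
  linarith

/-- The dual counterpart: a single error, so no auxiliary prox point. The shadow step carries no
`φ`, because it only has to have small regret against the linear error. -/
theorem composite_prox_step_le (hd : IsDistanceGenerating X α d) {φ : E → ℝ}
    (hφ : ConvexOn ℝ X φ) (g A : StrongDual ℝ E) {b q : ℝ}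
    (hb : 0 < b) (hq : q ∈ Set.Ioo (0 : ℝ) 1) {x₀ x₁ xv xv₁ x : E} (hx₀ : x₀ ∈ X)
    (hx₁ : x₁ ∈ X) (hxv : xv ∈ X) (hxv₁ : xv₁ ∈ X) (hx : x ∈ X)
    (hmin₁ : IsMinOn (fun v => φ v + (g + A) v + b * bregman d v x₀) X x₁)
    (hminv : IsMinOn (fun v => (-A) v + b * bregman d v xv) X xv₁) :
    φ x₁ - φ x + g (x₁ - x)
      ≤ b * (bregman d x x₀ - bregman d x x₁) + b * (bregman d x xv - bregman d x xv₁)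
      - q * b * α / 2 * ‖x₁ - x₀‖ ^ 2
      + (2 - q) / (2 * ((1 - q) * b * α)) * ‖A‖ ^ 2 + A (xv - x₀) := by
  have hα := hd.1
  have hq1 : 0 < 1 - q := by linarith [hq.2]
  have h1 := hd.le_of_isMinOn (hφ.add ((g + A).toLinearMap.convexOn hd.convex)) hx₁ hmin₁ hx
  have h2 := StrongDual.apply_le_sq_add_sq A (x₀ - x₁) (mul_pos (mul_pos hq1 hb) hα)
  have h3 := hd.mirror_step _ hb hxv hxv₁ hminv hx
  have h5 := mul_le_mul_of_nonneg_left (hd.le_bregman hx₀ hx₁) hb.le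
  have e : (2 - q) / (2 * ((1 - q) * b * α)) * ‖A‖ ^ 2
      = ‖A‖ ^ 2 / (2 * ((1 - q) * b * α)) + ‖A‖ ^ 2 / (2 * (b * α)) := by
    field_simp
    ring
  rw [norm_sub_rev] at h2
  rw [e]
  simp only [Pi.add_apply, ContinuousLinearMap.coe_coe, map_sub, add_apply, neg_apply,
    norm_neg] at *
  linarith

end IsDistanceGenerating

end Iteration

/-! ### Weights and telescoping. -/

section Parameters

variable {β θ η τ : ℕ → ℝ}

theorem gammaSeq_succ (θ : ℕ → ℝ) {t : ℕ} (ht : 1 ≤ t) :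
    gammaSeq θ (t + 1) = (θ (t + 1))⁻¹ * gammaSeq θ t := by
  obtain ⟨n, rfl⟩ := Nat.exists_eq_add_of_le' ht
  rfl

theorem gammaSeq_pos (hθ : ∀ t, 2 ≤ t → 0 < θ t) (t : ℕ) : 0 < gammaSeq θ t := by
  induction t with
  | zero => exact one_pos
  | succ t ih =>
    rcases Nat.eq_zero_or_pos t with rfl | ht
    · exact one_pos
    · rw [gammaSeq_succ θ ht]
      have := hθ (t + 1) (by omega)
      positivity

theorem one_le_of_recursion (hβ_one : β 1 = 1)
    (hβ : ∀ t, 1 ≤ t → β (t + 1) - 1 = β t * θ (t + 1)) (hθ : ∀ t, 2 ≤ t → 0 < θ t) {t : ℕ}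
    (ht : 1 ≤ t) : 1 ≤ β t := by
  induction t, ht using Nat.le_induction with
  | base => exact hβ_one.ge
  | succ t ht ih =>
    have h1 := hβ t ht
    have h2 := mul_pos (zero_lt_one.trans_le ih) (hθ (t + 1) (by omega))
    linarith

/-- The weighted sum of the one-step inequalities. -/
theorem weighted_telescope {p q αX αY LG LK A C : ℝ} (hp : p ∈ Set.Ioo (0 : ℝ) 1) (hαY : 0 < αY)
    (hη : ∀ t, 1 ≤ t → 0 < η t) (hτ : ∀ t, 1 ≤ t → 0 < τ t)
    (hβ : ∀ t, 1 ≤ t → β (t + 1) - 1 = β t * θ (t + 1))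
    (hθ : ∀ t, 2 ≤ t → 0 < θ t ∧ θ t ≤ min (η (t - 1) / η t) (τ (t - 1) / τ t))
    (hstep : ∀ t, 1 ≤ t → 0 ≤ q * αX / η t - LG / β t - LK ^ 2 * τ t / (p * αY))
    (g a c κ n m N r : ℕ → ℝ) (ha : ∀ t, 1 ≤ t → a t ∈ Set.Icc 0 A)
    (hc : ∀ t, 1 ≤ t → c t ∈ Set.Icc 0 C) (hrc : ∀ t, 1 ≤ t → αY / 2 * r t ^ 2 ≤ c (t + 1))
    (hκ : ∀ t, 1 ≤ t → -κ t ≤ LK * n t * r t)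
    (hfirst : β 1 * g 2 ≤ 1 / η 1 * (a 1 - a 2) + 1 / τ 1 * (c 1 - c 2) - κ 1
      - (q * αX / η 1 - LG / β 1) / 2 * n 1 ^ 2 - p * αY / (2 * τ 1) * m 1 ^ 2 + N 1)
    (hnext : ∀ t, 1 ≤ t → β (t + 1) * g (t + 2) - (β (t + 1) - 1) * g (t + 1)
      ≤ 1 / η (t + 1) * (a (t + 1) - a (t + 2)) + 1 / τ (t + 1) * (c (t + 1) - c (t + 2))
        - κ (t + 1) + θ (t + 1) * κ t + θ (t + 1) * (LK * n t * m (t + 1))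
        - (q * αX / η (t + 1) - LG / β (t + 1)) / 2 * n (t + 1) ^ 2
        - p * αY / (2 * τ (t + 1)) * m (t + 1) ^ 2 + N (t + 1))
    {t : ℕ} (ht : 1 ≤ t) :
    β t * gammaSeq θ t * g (t + 1) ≤ gammaSeq θ t / η t * A + gammaSeq θ t / τ t * C
      + ∑ i ∈ Finset.Icc 1 t, gammaSeq θ i * N i := by
  have hγ := gammaSeq_pos (θ := θ) fun t ht => (hθ t ht).1
  have hp0 := hp.1
  -- The induction carries two extra terms: the bilinear term `κ t`, cancelled by the extrapolation
  -- of the next iteration, and a negative multiple of `n t ^ 2`, kept to pay for the product `n t *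
  -- m (t + 1)` there.
  have key : ∀ t, 1 ≤ t → β t * gammaSeq θ t * g (t + 1)
      ≤ gammaSeq θ t / η t * (A - a (t + 1)) + gammaSeq θ t / τ t * (C - c (t + 1))
      + ∑ i ∈ Finset.Icc 1 t, gammaSeq θ i * N i - gammaSeq θ t * κ t
      - gammaSeq θ t * (LK ^ 2 * τ t / (p * αY)) / 2 * n t ^ 2 := by
    intro t ht
    induction t, ht using Nat.le_induction with
    | base =>
      have h1 := hη 1 le_rfl
      have h2 := hτ 1 le_rfl
      have h3 : 0 ≤ p * αY / (2 * τ 1) * m 1 ^ 2 := by positivity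
      have h4 := mul_le_mul_of_nonneg_left (ha 1 le_rfl).2 (one_div_pos.2 h1).le
      have h5 := mul_le_mul_of_nonneg_left (hc 1 le_rfl).2 (one_div_pos.2 h2).le
      have h6 := mul_nonneg (hstep 1 le_rfl) (sq_nonneg (n 1))
      have h7 : gammaSeq θ 1 = 1 := rfl
      rw [Finset.Icc_self, Finset.sum_singleton, h7]
      linarith
    | succ t ht ih =>
      have hγt := hγ t
      have hγs := hγ (t + 1)
      obtain ⟨hθ0, hθ1⟩ := hθ (t + 1) (by omega)
      have hηt := hη t ht
      have hτt := hτ t ht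
      have hηs := hη (t + 1) (by omega)
      have hτs := hτ (t + 1) (by omega)
      have e1 : gammaSeq θ (t + 1) * θ (t + 1) = gammaSeq θ t := by
        rw [gammaSeq_succ θ ht]
        field_simp
      have hθη : θ (t + 1) * η (t + 1) ≤ η t := by
        have := hθ1.trans (min_le_left _ _)
        rwa [Nat.add_sub_cancel, le_div_iff₀ hηs] at this
      have hθτ : θ (t + 1) * τ (t + 1) ≤ τ t := by
        have := hθ1.trans (min_le_right _ _)
        rwa [Nat.add_sub_cancel, le_div_iff₀ hτs] at this
      have hγη : gammaSeq θ t / η t ≤ gammaSeq θ (t + 1) / η (t + 1) := by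
        rw [div_le_div_iff₀ hηt hηs, ← e1, mul_assoc]
        exact mul_le_mul_of_nonneg_left hθη hγs.le
      have hγτ : gammaSeq θ t / τ t ≤ gammaSeq θ (t + 1) / τ (t + 1) := by
        rw [div_le_div_iff₀ hτt hτs, ← e1, mul_assoc]
        exact mul_le_mul_of_nonneg_left hθτ hγs.le
      have h1 := mul_le_mul_of_nonneg_left (hnext t ht) hγs.le
      have h2 := mul_le_mul_of_nonneg_right hγη (sub_nonneg.2 (ha (t + 1) (by omega)).2)
      have h3 := mul_le_mul_of_nonneg_right hγτ (sub_nonneg.2 (hc (t + 1) (by omega)).2)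
      have h4 := mul_nonneg hγs.le
        (mul_nonneg (hstep (t + 1) (by omega)) (sq_nonneg (n (t + 1))))
      have e2 : gammaSeq θ (t + 1) * ((β (t + 1) - 1) * g (t + 1))
          = β t * gammaSeq θ t * g (t + 1) := by
        rw [hβ t ht, ← e1]
        ring
      -- the coupling of consecutive iterations
      have h5 : gammaSeq θ t * (LK * n t * m (t + 1))
          ≤ gammaSeq θ t * (LK ^ 2 * τ t / (p * αY)) / 2 * n t ^ 2
            + gammaSeq θ (t + 1) * (p * αY / (2 * τ (t + 1)) * m (t + 1) ^ 2) := by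
        have e3 : gammaSeq θ t * (LK ^ 2 * (θ (t + 1) * τ (t + 1)) / (p * αY)) / 2 * n t ^ 2
            + gammaSeq θ (t + 1) * (p * αY / (2 * τ (t + 1)) * m (t + 1) ^ 2)
            - gammaSeq θ t * (LK * n t * m (t + 1))
            = gammaSeq θ (t + 1) / (2 * (p * αY) * τ (t + 1))
              * (LK * (θ (t + 1) * τ (t + 1)) * n t - p * αY * m (t + 1)) ^ 2 := by
          rw [← e1]
          field_simp
          ring
        -- The square above is completed with `θ (t + 1) * τ (t + 1)`; the step-size condition
        -- provides `τ t`, which is no smaller.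
        have h6 : gammaSeq θ t * (LK ^ 2 * (θ (t + 1) * τ (t + 1)) / (p * αY)) / 2 * n t ^ 2
            ≤ gammaSeq θ t * (LK ^ 2 * τ t / (p * αY)) / 2 * n t ^ 2 := by
          gcongr
        have h7 : 0 ≤ gammaSeq θ (t + 1) / (2 * (p * αY) * τ (t + 1))
              * (LK * (θ (t + 1) * τ (t + 1)) * n t - p * αY * m (t + 1)) ^ 2 := by
          positivity
        linarith
      rw [Finset.sum_Icc_succ_top (by omega)]
      have e4 : gammaSeq θ (t + 1) * (θ (t + 1) * κ t) = gammaSeq θ t * κ t := by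
        rw [← e1]
        ring
      have e5 : gammaSeq θ (t + 1) * (θ (t + 1) * (LK * n t * m (t + 1)))
          = gammaSeq θ t * (LK * n t * m (t + 1)) := by
        rw [← e1]
        ring
      have e6 : ∀ z w : ℝ, gammaSeq θ (t + 1) * (1 / z * w) = gammaSeq θ (t + 1) / z * w :=
        fun z w => by ring
      simp only [mul_add, mul_sub] at h1 e2 e4 e5 e6 h2 h3 h4 h5 ih ⊢
      have e7 := e6 (η (t + 1)) (a (t + 1))
      have e8 := e6 (η (t + 1)) (a (t + 2))
      have e9 := e6 (τ (t + 1)) (c (t + 1))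
      have e10 := e6 (τ (t + 1)) (c (t + 2))
      linarith
  have h0 := key t ht
  have hγt := hγ t
  have hηt := hη t ht
  have hτt := hτ t ht
  -- After the last iteration no extrapolation cancels `κ t`. It is absorbed by the reserved
  -- multiple of `n t ^ 2` and the fraction `p` of the last dual Bregman term, again by completing a
  -- square.
  have h1 : 0 ≤ gammaSeq θ t / η t * a (t + 1) :=
    mul_nonneg (by positivity) (ha (t + 1) (by omega)).1
  have h2 := mul_le_mul_of_nonneg_left (hrc t ht) (by positivity : 0 ≤ gammaSeq θ t / τ t)
  have h3 := mul_le_mul_of_nonneg_left (hκ t ht) hγt.le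
  have h4 : gammaSeq θ t * (LK ^ 2 * τ t / (p * αY)) / 2 * n t ^ 2
      + p * (gammaSeq θ t / τ t * (αY / 2 * r t ^ 2)) - gammaSeq θ t * (LK * n t * r t)
      = gammaSeq θ t / (2 * (p * αY) * τ t) * (LK * τ t * n t - p * αY * r t) ^ 2 := by
    field_simp
    ring
  have h5 : 0 ≤ gammaSeq θ t / (2 * (p * αY) * τ t) * (LK * τ t * n t - p * αY * r t) ^ 2 := by
    positivity
  have h6 : p * (gammaSeq θ t / τ t * (αY / 2 * r t ^ 2))
      ≤ gammaSeq θ t / τ t * (αY / 2 * r t ^ 2) :=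
    mul_le_of_le_one_left (by positivity) hp.2.le
  simp only [mul_sub] at h0
  linarith

end Parameters

/-! ### An elementary inequality for the exponential. -/

section SubGaussian

/-- For a centred variable the linear term integrates to zero, leaving a pure square in the
exponent. The constant 9/16 is small enough for the moment bound exp(3c²/4), on which the tail
exp(-λ²/3) depends. -/
theorem exp_le_add_exp_sq (x : ℝ) : Real.exp x ≤ x + Real.exp (9 / 16 * x ^ 2) := by
  rcases le_or_gt x 0 with h0 | h0
  · have h1 := Real.quadratic_le_exp_of_nonneg (neg_nonneg.2 h0)
    have h2 := Real.add_one_le_exp (9 / 16 * x ^ 2)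
    have h3 : Real.exp x * Real.exp (-x) = 1 := by rw [← Real.exp_add]; simp
    have h4 : Real.exp x * (1 - x + x ^ 2 / 2) ≤ 1 := by
      rw [← h3]
      exact mul_le_mul_of_nonneg_left (by linarith) (Real.exp_pos x).le
    have h5 : Real.exp x ≤ 1 + x + x ^ 2 / 2 := by
      have h6 : 1 ≤ (1 + x + x ^ 2 / 2) * (1 - x + x ^ 2 / 2) := by
        nlinarith [sq_nonneg (x ^ 2)]
      have h7 : 0 < 1 - x + x ^ 2 / 2 := by nlinarith [sq_nonneg x]
      exact le_of_mul_le_mul_right (h4.trans h6) h7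
    nlinarith [sq_nonneg x]
  rcases le_or_gt x 1 with h1 | h1
  -- Taylor polynomials bound the left side above and the right side below; their difference is x²
  -- times the polynomial in `h4`.
  · have h2 := Real.exp_bound' h0.le h1 (n := 5) (by norm_num)
    have h3 := Real.sum_le_exp_of_nonneg (by positivity : 0 ≤ 9 / 16 * x ^ 2) 4
    simp only [Finset.sum_range_succ, Finset.sum_range_zero, Nat.factorial] at h2 h3
    norm_num at h2 h3
    have h4 : 0 ≤ 1 / 16 - x / 6 + (81 / 512 - 1 / 24) * x ^ 2 - x ^ 3 / 100
        + 729 / 24576 * x ^ 4 := by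
      nlinarith [sq_nonneg (x - 18 / 25), mul_nonneg (sq_nonneg x) (sq_nonneg (x - 1 / 6))]
    have h5 := mul_nonneg (sq_nonneg x) h4
    nlinarith
  rcases le_or_gt (16 / 9) x with h2 | h2
  · have : x ≤ 9 / 16 * x ^ 2 := by nlinarith
    linarith [Real.exp_le_exp.2 this]
  -- On 1 < x < 16/9, after division by exp x, the claim is 1 ≤ x exp(-x) + exp(-x w). A
  -- second-order Taylor bound for exp(-x w) and the tangent bound exp(1 - x) ≥ 2 - x suffice;
  -- 0.3678 is just below 1/e.
  · set w := 1 - 9 / 16 * x with hw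
    have hx : x = 16 / 9 * (1 - w) := by rw [hw]; ring
    have hw0 : 0 ≤ w := by rw [hw]; linarith
    have hw1 : w ≤ 7 / 16 := by rw [hw]; linarith
    have hz : 9 / 16 * x ^ 2 - x = -(x * w) := by rw [hw]; ring
    have hzabs : |-(x * w)| ≤ 1 := by
      rw [abs_neg, abs_of_nonneg (by positivity)]
      nlinarith
    have h3 := (abs_le.1 (Real.exp_bound hzabs (n := 3) (by norm_num))).1
    rw [abs_neg, abs_of_nonneg (by positivity : 0 ≤ x * w)] at h3
    simp only [Finset.sum_range_succ, Finset.sum_range_zero, Nat.factorial] at h3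
    norm_num at h3
    have h4 : (0.3678 : ℝ) * (2 - x) ≤ Real.exp (-x) := by
      have h5 : Real.exp (-x) = Real.exp (-1) * Real.exp (1 - x) := by
        rw [← Real.exp_add]
        ring_nf
      have h6 : (0.3678 : ℝ) ≤ Real.exp (-1) := by
        rw [Real.exp_neg, le_inv_comm₀ (by norm_num) (Real.exp_pos 1)]
        exact Real.exp_one_lt_d9.le.trans (by norm_num)
      rw [h5]
      have h7 := Real.add_one_le_exp (1 - x)
      exact mul_le_mul h6 (by linarith) (by linarith) (Real.exp_pos _).le
    have h8 : 0 ≤ -w + x * w ^ 2 / 2 - 2 / 9 * (x ^ 2 * w ^ 3) + 0.3678 * (2 - x) := by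
      have h9 : (1 - w) * w ≤ 63 / 256 := by nlinarith
      have h10 : (1 - w) * w * ((1 - w) * w ^ 2) ≤ 63 / 256 * ((1 - w) * w ^ 2) :=
        mul_le_mul_of_nonneg_right h9 (mul_nonneg (by linarith) (sq_nonneg w))
      rw [hx]
      nlinarith [mul_nonneg hw0 (sub_nonneg.2 hw1), mul_nonneg hw0 (sq_nonneg (7 / 16 - w)),
        sq_nonneg (7 / 16 - w)]
    have h11 : 1 - x * Real.exp (-x) ≤ Real.exp (9 / 16 * x ^ 2 - x) := by
      rw [hz]
      have h12 := mul_le_mul_of_nonneg_left h4 h0.le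
      have h13 := mul_nonneg h0.le h8
      nlinarith
    have h14 := mul_le_mul_of_nonneg_right h11 (Real.exp_pos x).le
    rw [sub_mul, mul_assoc, ← Real.exp_add, ← Real.exp_add] at h14
    norm_num at h14
    linarith

end SubGaussian

/-! ### From light tails to exponential moments. -/

section SubGaussianMgf

variable {Ξ : Type*} [MeasurableSpace Ξ] {ν : Measure Ξ} [IsProbabilityMeasure ν]

theorem lintegral_exp_le_of_exp_sq {X : Ξ → ℝ} {c : ℝ} (hc : 0 < c) (hX : Integrable X ν)
    (hX0 : ∫ s, X s ∂ν = 0) (hint : Integrable (fun s => Real.exp (X s ^ 2 / c ^ 2)) ν)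
    (hle : ∫ s, Real.exp (X s ^ 2 / c ^ 2) ∂ν ≤ Real.exp 1) :
    ∫⁻ s, ENNReal.ofReal (Real.exp (X s)) ∂ν ≤ ENNReal.ofReal (Real.exp (3 / 4 * c ^ 2)) := by
  -- it is enough to bound the exponential by an affine function of `X` and `exp (X² / c²)`
  suffices h : ∃ k a b : ℝ, 0 ≤ b ∧ a + b ≤ Real.exp (3 / 4 * c ^ 2) ∧
      ∀ s, Real.exp (X s) ≤ k * X s + (a + b * (Real.exp (X s ^ 2 / c ^ 2) / Real.exp 1)) by
    obtain ⟨k, a, b, hb, hab, h⟩ := h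
    have hint1 : Integrable
        (fun s => a + b * (Real.exp (X s ^ 2 / c ^ 2) / Real.exp 1)) ν :=
      (integrable_const a).add ((hint.div_const _).const_mul b)
    have hint' : Integrable
        (fun s => k * X s + (a + b * (Real.exp (X s ^ 2 / c ^ 2) / Real.exp 1))) ν :=
      (hX.const_mul k).add hint1
    refine (lintegral_mono fun s => ENNReal.ofReal_le_ofReal (h s)).trans ?_
    rw [← ofReal_integral_eq_lintegral_ofReal hint'
      (Filter.Eventually.of_forall fun s => (Real.exp_pos _).le.trans (h s))]
    refine ENNReal.ofReal_le_ofReal (le_trans ?_ hab)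
    rw [integral_add (hX.const_mul k) hint1,
      integral_add (integrable_const a) ((hint.div_const _).const_mul b), integral_const_mul,
      integral_const_mul, integral_div, hX0]
    simp only [mul_zero, zero_add, integral_const, probReal_univ, smul_eq_mul, one_mul]
    have h1 : (∫ s, Real.exp (X s ^ 2 / c ^ 2) ∂ν) / Real.exp 1 ≤ 1 :=
      (div_le_one (Real.exp_pos 1)).2 hle
    nlinarith
  -- Convexity of exp on the segment from 0 to z - 1 turns a fraction `r` of the exponent into an
  -- affine function of exp z, whose mean is controlled when z is X²/c².
  have hexp : ∀ r z : ℝ, 0 ≤ r → r ≤ 1 →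
      Real.exp (r * z) ≤ Real.exp r * (1 - r + r * (Real.exp z / Real.exp 1)) := by
    intro r z h0 h1
    have h := convexOn_exp.2 (Set.mem_univ 0) (Set.mem_univ (z - 1)) (sub_nonneg.2 h1) h0 (by ring)
    simp only [smul_eq_mul, mul_zero, zero_add, Real.exp_zero, mul_one] at h
    rw [← Real.exp_sub]
    calc Real.exp (r * z) = Real.exp r * Real.exp (r * (z - 1)) := by
          rw [← Real.exp_add]
          ring_nf
      _ ≤ _ := mul_le_mul_of_nonneg_left h (Real.exp_pos r).le
  rcases le_or_gt (9 / 16 * c ^ 2) 1 with h1 | h1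
  · refine ⟨1, Real.exp (9 / 16 * c ^ 2) * (1 - 9 / 16 * c ^ 2),
      Real.exp (9 / 16 * c ^ 2) * (9 / 16 * c ^ 2), by positivity, ?_, fun s => ?_⟩
    · rw [← mul_add, sub_add_cancel, mul_one]
      exact Real.exp_le_exp.2 (by nlinarith [sq_nonneg c])
    · have h2 := exp_le_add_exp_sq (X s)
      have h3 := hexp (9 / 16 * c ^ 2) (X s ^ 2 / c ^ 2) (by positivity) h1
      have h4 : 9 / 16 * c ^ 2 * (X s ^ 2 / c ^ 2) = 9 / 16 * X s ^ 2 := by field_simp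
      rw [h4] at h3
      linarith
  -- For large `c` Young's inequality replaces centring. The threshold c² = 16/9 is exactly where
  -- 2/3 = 3c²/8, so the exponents add up to at most 3c²/4.
  · refine ⟨0, Real.exp (3 / 8 * c ^ 2) * Real.exp (2 / 3) * (1 - 2 / 3),
      Real.exp (3 / 8 * c ^ 2) * Real.exp (2 / 3) * (2 / 3), by positivity, ?_, fun s => ?_⟩
    · rw [← mul_add, sub_add_cancel, mul_one, ← Real.exp_add]
      exact Real.exp_le_exp.2 (by linarith)
    · have h2 : X s ≤ 3 / 8 * c ^ 2 + 2 / 3 * (X s ^ 2 / c ^ 2) := by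
        have e : 3 / 8 * c ^ 2 + 2 / 3 * (X s ^ 2 / c ^ 2) - X s
            = 2 / 3 * (X s / c - 3 / 4 * c) ^ 2 := by
          field_simp
          ring
        have : 0 ≤ 2 / 3 * (X s / c - 3 / 4 * c) ^ 2 := by positivity
        linarith
      have h3 := hexp (2 / 3) (X s ^ 2 / c ^ 2) (by norm_num) (by norm_num)
      have h4 := Real.exp_le_exp.2 h2
      rw [Real.exp_add] at h4
      have h5 := mul_le_mul_of_nonneg_left h3 (Real.exp_pos (3 / 8 * c ^ 2)).le
      linarith

variable {U : Type*} [NormedAddCommGroup U] [NormedSpace ℝ U]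

theorem HasMean.integral_sub_apply {Z : Ξ → StrongDual ℝ U} {m : StrongDual ℝ U}
    (hmean : HasMean ν Z m) (v : U) :
    Integrable (fun s => (Z s - m) v) ν ∧ ∫ s, (Z s - m) v ∂ν = 0 := by
  have hsub : Integrable (fun s => Z s - m) ν := hmean.1.sub (integrable_const m)
  refine ⟨hsub.apply_continuousLinearMap v, ?_⟩
  rw [← ContinuousLinearMap.integral_apply hsub, integral_sub hmean.1 (integrable_const m),
    hmean.2]
  simp

theorem HasLightTail.lintegral_exp_apply_le {Z : Ξ → StrongDual ℝ U} {m : StrongDual ℝ U} {σ : ℝ}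
    (hmean : HasMean ν Z m) (htail : HasLightTail ν Z m σ) {v : U} {D : ℝ}
    (hv : ‖v‖ ≤ D) (r : ℝ) :
    ∫⁻ s, ENNReal.ofReal (Real.exp (r * (Z s - m) v)) ∂ν
      ≤ ENNReal.ofReal (Real.exp (3 / 4 * (r * (D * σ)) ^ 2)) := by
  -- If one factor vanishes, the exponent is zero almost surely; for `σ = 0` this is the convention
  -- in `HasLightTail`.
  by_cases hc : r * (D * σ) = 0
  · have h0 : ∀ᵐ s ∂ν, r * (Z s - m) v = 0 := by
      rcases mul_eq_zero.1 hc with hr | h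
      · simp [hr]
      rcases mul_eq_zero.1 h with hD | hσ
      · have : v = 0 := norm_le_zero_iff.1 (hD ▸ hv)
        simp [this]
      · filter_upwards [htail.1 hσ] with s hs
        simp [hs]
    rw [hc, lintegral_congr_ae (h0.mono fun s hs => by simp only [hs]; rfl)]
    simp
  have hc' : 0 < |r * (D * σ)| := abs_pos.2 hc
  have hσ : σ ≠ 0 := fun h => hc (by simp [h])
  have hD : D ≠ 0 := fun h => hc (by simp [h])
  have hr : r ≠ 0 := fun h => hc (by simp [h])
  obtain ⟨happ, hzero⟩ := hmean.integral_sub_apply v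
  have hpt : ∀ s, (r * (Z s - m) v) ^ 2 / |r * (D * σ)| ^ 2 ≤ ‖Z s - m‖ ^ 2 / σ ^ 2 := by
    intro s
    rw [sq_abs, div_le_div_iff₀ (by positivity) (by positivity)]
    have h1 : ((Z s - m) v) ^ 2 ≤ (‖Z s - m‖ * D) ^ 2 := by
      rw [← sq_abs]
      have h2 : |(Z s - m) v| ≤ ‖Z s - m‖ * ‖v‖ := (Z s - m).le_opNorm v
      exact pow_le_pow_left₀ (abs_nonneg _)
        (h2.trans (mul_le_mul_of_nonneg_left hv (norm_nonneg _))) 2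
    have h3 := mul_le_mul_of_nonneg_left h1 (mul_nonneg (sq_nonneg r) (sq_nonneg σ))
    nlinarith
  have hint : Integrable
      (fun s => Real.exp ((r * (Z s - m) v) ^ 2 / |r * (D * σ)| ^ 2)) ν := by
    refine htail.2.1.mono ?_ (Filter.Eventually.of_forall fun s => ?_)
    · exact (by fun_prop : Continuous fun x : ℝ => Real.exp ((r * x) ^ 2 / |r * (D * σ)| ^ 2))
        |>.comp_aestronglyMeasurable happ.aestronglyMeasurable
    · rw [Real.norm_of_nonneg (Real.exp_pos _).le, Real.norm_of_nonneg (Real.exp_pos _).le]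
      exact Real.exp_le_exp.2 (hpt s)
  have h := lintegral_exp_le_of_exp_sq hc' (happ.const_mul r)
    (by rw [integral_const_mul, hzero, mul_zero]) hint
    ((integral_mono hint htail.2.1 fun s => Real.exp_le_exp.2 (hpt s)).trans htail.2.2)
  rwa [sq_abs] at h

end SubGaussianMgf

/-! ### Integrating out a sample independent of the history. -/

section FreshSample

variable {Ω Ξ H : Type*} {mΩ : MeasurableSpace Ω} [MeasurableSpace Ξ] [MeasurableSpace H]
  {P : Measure Ω} [IsProbabilityMeasure P] {h : Ω → H} {s : Ω → Ξ}

theorem IndepFun.lintegral_comp_prodMk (hh : Measurable h) (hs : Measurable s)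
    (hi : IndepFun h s P) {f : H × Ξ → ENNReal} (hf : Measurable f) :
    ∫⁻ ω, f (h ω, s ω) ∂P = ∫⁻ ω, ∫⁻ x, f (h ω, x) ∂(P.map s) ∂P := by
  have := Measure.isProbabilityMeasure_map hs.aemeasurable (μ := P)
  have h1 := (indepFun_iff_map_prod_eq_prod_map_map hh.aemeasurable hs.aemeasurable).1 hi
  rw [← lintegral_map hf (hh.prodMk hs), h1, lintegral_prod _ hf.aemeasurable,
    lintegral_map hf.lintegral_prod_right' hh]

theorem IndepFun.integral_comp_prodMk (hh : Measurable h) (hs : Measurable s)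
    (hi : IndepFun h s P) {f : H × Ξ → ℝ} (hf : Measurable f)
    (hint : Integrable (fun ω => f (h ω, s ω)) P) :
    ∫ ω, f (h ω, s ω) ∂P = ∫ ω, ∫ x, f (h ω, x) ∂(P.map s) ∂P := by
  have := Measure.isProbabilityMeasure_map hs.aemeasurable (μ := P)
  have h1 := (indepFun_iff_map_prod_eq_prod_map_map hh.aemeasurable hs.aemeasurable).1 hi
  have hint' : Integrable f ((P.map h).prod (P.map s)) := by
    rw [← h1]
    exact (integrable_map_measure hf.aestronglyMeasurable (hh.prodMk hs).aemeasurable).2 hint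
  rw [← integral_map (hh.prodMk hs).aemeasurable hf.aestronglyMeasurable, h1,
    integral_prod _ hint', integral_map hh.aemeasurable
      hf.stronglyMeasurable.integral_prod_right'.aestronglyMeasurable]

/-- The weight `w` is an arbitrary nonnegative function of the history, so the inequality does the
work of a bound on a conditional expectation given the past. -/
theorem IndepFun.lintegral_mul_comp_prodMk_le {w : Ω → ENNReal}
    (hwh : Measurable fun ω => (w ω, h ω)) (hs : Measurable s)
    (hi : IndepFun (fun ω => (w ω, h ω)) s P) {f : H × Ξ → ENNReal} (hf : Measurable f)
    {c : ENNReal} (hc : c ≠ ⊤) (hle : ∀ ω, ∫⁻ x, f (h ω, x) ∂(P.map s) ≤ c) :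
    ∫⁻ ω, w ω * f (h ω, s ω) ∂P ≤ c * ∫⁻ ω, w ω ∂P := by
  rw [IndepFun.lintegral_comp_prodMk hwh hs hi (f := fun z => z.1.1 * f (z.1.2, z.2))
    ((measurable_fst.comp measurable_fst).mul (hf.comp
      ((measurable_snd.comp measurable_fst).prodMk measurable_snd))),
    ← lintegral_const_mul' _ _ hc]
  refine lintegral_mono fun ω => ?_
  have hsec : Measurable fun x => f (h ω, x) := hf.comp measurable_prodMk_left
  change ∫⁻ x, w ω * f (h ω, x) ∂(P.map s) ≤ c * w ω
  rw [lintegral_const_mul _ hsec, mul_comm]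
  exact mul_le_mul' (hle ω) le_rfl

end FreshSample

/-! ### Oracle assumptions transferred from fixed to random query points. -/

section EstimatorAtRandomPoint

variable {Ω Ξ V U : Type*} {mΩ : MeasurableSpace Ω} [MeasurableSpace Ξ] [MeasurableSpace V]
  [NormedAddCommGroup U] [NormedSpace ℝ U] [FiniteDimensional ℝ U]
  {P : Measure Ω} [IsProbabilityMeasure P] {Z : V → Ξ → StrongDual ℝ U}
  {m : V → StrongDual ℝ U} {S : Set V} {v : Ω → V} {s : Ω → Ξ} {σ : ℝ}

theorem measurable_estimator_error (hZ : Measurable (Function.uncurry Z)) (hm : Measurable m) :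
    Measurable fun z : V × Ξ => Z z.1 z.2 - m z.1 := by
  have := secondCountable_strongDual (E := U)
  exact hZ.sub (hm.comp measurable_fst)

theorem measurable_dual_apply [MeasurableSpace U] [BorelSpace U] :
    Measurable fun z : StrongDual ℝ U × U => z.1 z.2 := by
  have := secondCountable_strongDual (E := U)
  have := FiniteDimensional.proper_real U
  exact (isBoundedBilinearMap_apply (𝕜 := ℝ) (E := U) (F := ℝ)).continuous.measurable

theorem integrable_error_sq (hZ : Measurable (Function.uncurry Z)) (hm : Measurable m)
    (hv : Measurable v) (hs : Measurable s) (hi : IndepFun v s P) (hvS : ∀ ω, v ω ∈ S)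
    (hvar : ∀ x ∈ S, HasVarianceLE (P.map s) (Z x) (m x) σ) :
    Integrable (fun ω => ‖Z (v ω) (s ω) - m (v ω)‖ ^ 2) P ∧
      ∫ ω, ‖Z (v ω) (s ω) - m (v ω)‖ ^ 2 ∂P ≤ σ ^ 2 := by
  have hmeas := ((measurable_estimator_error hZ hm).norm.pow_const 2)
  have hle : ∫⁻ ω, ENNReal.ofReal (‖Z (v ω) (s ω) - m (v ω)‖ ^ 2) ∂P
      ≤ ENNReal.ofReal (σ ^ 2) := by
    rw [IndepFun.lintegral_comp_prodMk hv hs hi hmeas.ennreal_ofReal]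
    calc _ ≤ ∫⁻ _, ENNReal.ofReal (σ ^ 2) ∂P := lintegral_mono fun ω => by
          have h := hvar (v ω) (hvS ω)
          rw [← ofReal_integral_eq_lintegral_ofReal h.1
            (Filter.Eventually.of_forall fun x => sq_nonneg _)]
          exact ENNReal.ofReal_le_ofReal h.2
      _ = _ := by simp
  have hm' : AEStronglyMeasurable (fun ω => ‖Z (v ω) (s ω) - m (v ω)‖ ^ 2) P :=
    (hmeas.comp (hv.prodMk hs)).aestronglyMeasurable
  have hint := (lintegral_ofReal_ne_top_iff_integrable hm'
    (Filter.Eventually.of_forall fun x => sq_nonneg _)).1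
    (ne_top_of_le_ne_top ENNReal.ofReal_ne_top hle)
  refine ⟨hint, ?_⟩
  rw [← ofReal_integral_eq_lintegral_ofReal hint
    (Filter.Eventually.of_forall fun x => sq_nonneg _)] at hle
  exact (ENNReal.ofReal_le_ofReal_iff (sq_nonneg σ)).1 hle

/-- Point and direction are both independent of the sample, so Fubini reduces the mean to
unbiasedness at fixed points. Boundedness of the direction and the second moment give integrability.
-/
theorem integral_error_apply_eq_zero [MeasurableSpace U] [BorelSpace U]
    (hZ : Measurable (Function.uncurry Z)) (hm : Measurable m)
    {u : Ω → U} (hvu : Measurable fun ω => (v ω, u ω)) (hs : Measurable s)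
    (hi : IndepFun (fun ω => (v ω, u ω)) s P) (hvS : ∀ ω, v ω ∈ S) {D : ℝ} (hu : ∀ ω, ‖u ω‖ ≤ D)
    (hmean : ∀ x ∈ S, HasMean (P.map s) (Z x) (m x))
    (hint : Integrable (fun ω => ‖Z (v ω) (s ω) - m (v ω)‖ ^ 2) P) :
    Integrable (fun ω => (Z (v ω) (s ω) - m (v ω)) (u ω)) P ∧
      ∫ ω, (Z (v ω) (s ω) - m (v ω)) (u ω) ∂P = 0 := by
  have := Measure.isProbabilityMeasure_map hs.aemeasurable (μ := P)
  have hmeas : Measurable fun z : (V × U) × Ξ => (Z z.1.1 z.2 - m z.1.1) z.1.2 :=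
    measurable_dual_apply.comp (((measurable_estimator_error hZ hm).comp
      ((measurable_fst.comp measurable_fst).prodMk measurable_snd)).prodMk
        (measurable_snd.comp measurable_fst))
  have hint' : Integrable (fun ω => (Z (v ω) (s ω) - m (v ω)) (u ω)) P := by
    refine (((integrable_const 1).add hint).mul_const D).mono
      (hmeas.comp (hvu.prodMk hs)).aestronglyMeasurable (Filter.Eventually.of_forall fun ω => ?_)
    have hD : 0 ≤ D := (norm_nonneg _).trans (hu ω)
    have h1 : ‖(Z (v ω) (s ω) - m (v ω)) (u ω)‖ ≤ ‖Z (v ω) (s ω) - m (v ω)‖ * D :=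
      ((Z (v ω) (s ω) - m (v ω)).le_opNorm _).trans
        (mul_le_mul_of_nonneg_left (hu ω) (norm_nonneg _))
    refine h1.trans (le_trans ?_ (le_abs_self _))
    simp only [Pi.add_apply]
    exact mul_le_mul_of_nonneg_right
      (by nlinarith [sq_nonneg (‖Z (v ω) (s ω) - m (v ω)‖ - 1)]) hD
  refine ⟨hint', ?_⟩
  rw [IndepFun.integral_comp_prodMk hvu hs hi hmeas hint']
  refine (integral_congr_ae (Filter.Eventually.of_forall fun ω => ?_)).trans
    (integral_zero Ω ℝ)
  exact ((hmean (v ω) (hvS ω)).integral_sub_apply (u ω)).2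

theorem HasLightTail.lintegral_exp_error_le (hZ : Measurable (Function.uncurry Z))
    (hm : Measurable m)
    (hv : Measurable v) (hs : Measurable s) (hi : IndepFun v s P) (hvS : ∀ ω, v ω ∈ S)
    (htail : ∀ x ∈ S, HasLightTail (P.map s) (Z x) (m x) σ) :
    (∫⁻ ω, ENNReal.ofReal (Real.exp (‖Z (v ω) (s ω) - m (v ω)‖ ^ 2 / σ ^ 2)) ∂P
      ≤ ENNReal.ofReal (Real.exp 1)) ∧
    (σ = 0 → ∀ᵐ ω ∂P, Z (v ω) (s ω) - m (v ω) = 0) := by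
  have hmeas := measurable_estimator_error hZ hm
  constructor
  · rw [IndepFun.lintegral_comp_prodMk hv hs hi
      (f := fun z => ENNReal.ofReal (Real.exp (‖Z z.1 z.2 - m z.1‖ ^ 2 / σ ^ 2)))
      ((Real.measurable_exp.comp ((hmeas.norm.pow_const 2).div_const _)).ennreal_ofReal)]
    calc _ ≤ ∫⁻ _, ENNReal.ofReal (Real.exp 1) ∂P := lintegral_mono fun ω => by
          have h := (htail (v ω) (hvS ω)).2
          rw [← ofReal_integral_eq_lintegral_ofReal h.1
            (Filter.Eventually.of_forall fun x => (Real.exp_pos _).le)]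
          exact ENNReal.ofReal_le_ofReal h.2
      _ = _ := by simp
  · intro hσ
    have hzero : ∫⁻ ω, ENNReal.ofReal ‖Z (v ω) (s ω) - m (v ω)‖ ∂P = 0 := by
      rw [IndepFun.lintegral_comp_prodMk hv hs hi
        (f := fun z => ENNReal.ofReal ‖Z z.1 z.2 - m z.1‖) hmeas.norm.ennreal_ofReal]
      refine (lintegral_congr fun ω => ?_).trans lintegral_zero
      refine (lintegral_congr_ae ?_).trans lintegral_zero
      filter_upwards [(htail (v ω) (hvS ω)).1 hσ] with x hx
      rw [hx, sub_self, norm_zero, ENNReal.ofReal_zero]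
    have hzero := (lintegral_eq_zero_iff
      (hmeas.norm.ennreal_ofReal.comp (hv.prodMk hs))).1 hzero
    filter_upwards [hzero] with ω hω
    exact norm_le_zero_iff.1 (ENNReal.ofReal_eq_zero.1 hω)

theorem HasLightTail.lintegral_mul_exp_le [MeasurableSpace U] [BorelSpace U]
    (hZ : Measurable (Function.uncurry Z)) (hm : Measurable m)
    {u : Ω → U} {w : Ω → ENNReal} (hvu : Measurable fun ω => (w ω, v ω, u ω)) (hs : Measurable s)
    (hi : IndepFun (fun ω => (w ω, v ω, u ω)) s P) (hvS : ∀ ω, v ω ∈ S) {D : ℝ}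
    (hu : ∀ ω, ‖u ω‖ ≤ D)
    (hmean : ∀ x ∈ S, HasMean (P.map s) (Z x) (m x))
    (htail : ∀ x ∈ S, HasLightTail (P.map s) (Z x) (m x) σ) (r : ℝ) :
    ∫⁻ ω, w ω * ENNReal.ofReal (Real.exp (r * (Z (v ω) (s ω) - m (v ω)) (u ω))) ∂P
      ≤ ENNReal.ofReal (Real.exp (3 / 4 * (r * (D * σ)) ^ 2)) * ∫⁻ ω, w ω ∂P := by
  have := Measure.isProbabilityMeasure_map hs.aemeasurable (μ := P)
  have hmeas : Measurable fun z : (V × U) × Ξ => (Z z.1.1 z.2 - m z.1.1) z.1.2 :=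
    measurable_dual_apply.comp (((measurable_estimator_error hZ hm).comp
      ((measurable_fst.comp measurable_fst).prodMk measurable_snd)).prodMk
        (measurable_snd.comp measurable_fst))
  exact IndepFun.lintegral_mul_comp_prodMk_le (h := fun ω => (v ω, u ω)) hvu hs hi
    (f := fun z => ENNReal.ofReal (Real.exp (r * (Z z.1.1 z.2 - m z.1.1) z.1.2)))
    (Real.measurable_exp.comp (hmeas.const_mul r)).ennreal_ofReal ENNReal.ofReal_ne_top
    fun ω => (htail (v ω) (hvS ω)).lintegral_exp_apply_le (hmean (v ω) (hvS ω)) (hu ω) r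

end EstimatorAtRandomPoint

/-! ### Tail bounds for sums. -/

section Tails

variable {Ω : Type*} {mΩ : MeasurableSpace Ω} {P : Measure Ω}

theorem measure_le_of_lintegral_exp_le {X : Ω → ℝ} (hX : Measurable X) {a b : ℝ}
    (h : ∫⁻ ω, ENNReal.ofReal (Real.exp (X ω)) ∂P ≤ ENNReal.ofReal (Real.exp a)) :
    P {ω | b ≤ X ω} ≤ ENNReal.ofReal (Real.exp (a - b)) := by
  have h1 := meas_ge_le_lintegral_div (μ := P) (hX.exp.ennreal_ofReal).aemeasurable
    (ε := ENNReal.ofReal (Real.exp b)) (by simpa using Real.exp_pos b) ENNReal.ofReal_ne_top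
  have h2 : {ω | b ≤ X ω} ⊆
      {ω | ENNReal.ofReal (Real.exp b) ≤ ENNReal.ofReal (Real.exp (X ω))} :=
    fun ω hω => ENNReal.ofReal_le_ofReal (Real.exp_le_exp.2 hω)
  refine (measure_mono h2).trans (h1.trans ?_)
  rw [Real.exp_sub, ENNReal.ofReal_div_of_pos (Real.exp_pos b)]
  exact ENNReal.div_le_div_right h _

/-- Tail bound for a sum of conditionally sub-Gaussian increments. -/
theorem measure_sum_gt_le [IsProbabilityMeasure P] {m : ℕ → MeasurableSpace Ω} (hm : ∀ i, m i ≤ mΩ) (hmono : Monotone m)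
    {X : ℕ → Ω → ℝ} {c : ℕ → ℝ} (hX : ∀ i, 1 ≤ i → Measurable[m (i + 1)] (X i))
    (hmgf : ∀ i, 1 ≤ i → ∀ r : ℝ, ∀ w : Ω → ENNReal, Measurable[m i] w →
      ∫⁻ ω, w ω * ENNReal.ofReal (Real.exp (r * X i ω)) ∂P
        ≤ ENNReal.ofReal (Real.exp (3 / 4 * (r * c i) ^ 2)) * ∫⁻ ω, w ω ∂P)
    (t : ℕ) {lam : ℝ} (hlam : 0 < lam) :
    P {ω | lam * Real.sqrt (∑ i ∈ Finset.Icc 1 t, c i ^ 2) < ∑ i ∈ Finset.Icc 1 t, X i ω}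
      ≤ ENNReal.ofReal (Real.exp (-lam ^ 2 / 3)) := by
  have hmeas : ∀ t, Measurable[m (t + 1)] (fun ω => ∑ i ∈ Finset.Icc 1 t, X i ω) := by
    intro t
    refine Finset.measurable_sum _ fun i hi => ?_
    rw [Finset.mem_Icc] at hi
    exact (hX i hi.1).mono (hmono (by omega)) le_rfl
  have hexp : ∀ r : ℝ, ∀ t, ∫⁻ ω, ENNReal.ofReal (Real.exp (r * ∑ i ∈ Finset.Icc 1 t, X i ω)) ∂P
      ≤ ENNReal.ofReal (Real.exp (3 / 4 * r ^ 2 * ∑ i ∈ Finset.Icc 1 t, c i ^ 2)) := by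
    intro r t
    induction t with
    | zero => simp
    | succ t ih =>
      have h := hmgf (t + 1) (by omega) r
        (fun ω => ENNReal.ofReal (Real.exp (r * ∑ i ∈ Finset.Icc 1 t, X i ω)))
        ((hmeas t).const_mul r).exp.ennreal_ofReal
      simp only [← ENNReal.ofReal_mul (Real.exp_pos _).le, ← Real.exp_add, ← mul_add] at h
      simp only [Finset.sum_Icc_succ_top (Nat.le_add_left 1 t)]
      refine h.trans ((mul_le_mul_right ih _).trans (le_of_eq ?_))
      rw [← ENNReal.ofReal_mul (Real.exp_pos _).le, ← Real.exp_add]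
      congr 2
      ring
  have hS : Measurable (fun ω => ∑ i ∈ Finset.Icc 1 t, X i ω) :=
    (hmeas t).mono (hm _) le_rfl
  set V := ∑ i ∈ Finset.Icc 1 t, c i ^ 2 with hV
  have hV0 : 0 ≤ V := Finset.sum_nonneg fun i _ => sq_nonneg _
  rcases hV0.eq_or_lt with h0 | hpos
  · -- degenerate case: the sum exceeds no positive level with larger probability
    have hlevel : ∀ n : ℕ, P {ω | 1 / ((n : ℝ) + 1) ≤ ∑ i ∈ Finset.Icc 1 t, X i ω}
        ≤ ENNReal.ofReal (Real.exp (-lam ^ 2 / 3)) := by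
      intro n
      -- With zero variance proxy every exponential moment is at most 1, so the multiplier may grow
      -- with the inverse of the level 1/(n+1).
      have hr : 0 < lam ^ 2 / 3 * ((n : ℝ) + 1) := by positivity
      have h1 := measure_le_of_lintegral_exp_le (b := lam ^ 2 / 3) (hS.const_mul _)
        (hexp (lam ^ 2 / 3 * ((n : ℝ) + 1)) t)
      rw [← hV, ← h0, mul_zero, zero_sub, ← neg_div] at h1
      refine (measure_mono fun ω hω => ?_).trans h1
      rw [Set.mem_ofPred_eq] at hω
      have h2 := mul_le_mul_of_nonneg_left hω hr.le
      have h3 : lam ^ 2 / 3 * ((n : ℝ) + 1) * (1 / ((n : ℝ) + 1)) = lam ^ 2 / 3 := by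
        field_simp
      rw [h3] at h2
      exact h2
    have hunion : {ω | lam * Real.sqrt V < ∑ i ∈ Finset.Icc 1 t, X i ω}
        ⊆ ⋃ n : ℕ, {ω | 1 / ((n : ℝ) + 1) ≤ ∑ i ∈ Finset.Icc 1 t, X i ω} := by
      intro ω hω
      rw [Set.mem_ofPred_eq, ← h0, Real.sqrt_zero, mul_zero] at hω
      obtain ⟨n, hn⟩ := exists_nat_one_div_lt hω
      exact Set.mem_iUnion.2 ⟨n, hn.le⟩
    have hmonoU : Monotone fun n : ℕ =>
        {ω | 1 / ((n : ℝ) + 1) ≤ ∑ i ∈ Finset.Icc 1 t, X i ω} := by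
      intro a b hab ω hω
      simp only [Set.mem_ofPred_eq] at hω ⊢
      exact le_trans (Nat.one_div_le_one_div hab) hω
    exact (measure_mono hunion).trans
      (le_of_tendsto' (tendsto_measure_iUnion_atTop hmonoU) hlevel)
  · have hsq : 0 < Real.sqrt V := Real.sqrt_pos.2 hpos
    -- The multiplier minimizing 3/4 r² V - r λ √V; the minimum is -λ²/3.
    have hr : 0 < 2 * lam / (3 * Real.sqrt V) := by positivity
    have h1 := measure_le_of_lintegral_exp_le (b := 2 * lam ^ 2 / 3) (hS.const_mul _)
      (hexp (2 * lam / (3 * Real.sqrt V)) t)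
    have h2 : 3 / 4 * (2 * lam / (3 * Real.sqrt V)) ^ 2 * V - 2 * lam ^ 2 / 3
        = -lam ^ 2 / 3 := by
      rw [div_pow, mul_pow, mul_pow, Real.sq_sqrt hV0]
      field_simp
      ring
    rw [← hV, h2] at h1
    refine (measure_mono fun ω hω => ?_).trans h1
    have h3 := mul_le_mul_of_nonneg_left (le_of_lt hω) hr.le
    have h4 : 2 * lam / (3 * Real.sqrt V) * (lam * Real.sqrt V) = 2 * lam ^ 2 / 3 := by
      field_simp
    rw [h4] at h3
    exact h3

/-- Jensen's inequality for the normalized weights bounds the exponential of the average by the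
average of the exponentials, and Markov's inequality finishes. No independence is involved. -/
theorem measure_weighted_sum_gt_le [IsProbabilityMeasure P] {ι : Type*} (I : Finset ι) {w : ι → ℝ}
    (hw : ∀ i ∈ I, 0 ≤ w i) {Y : ι → Ω → ℝ} (hY : ∀ i ∈ I, Measurable (Y i))
    (hexp : ∀ i ∈ I, ∫⁻ ω, ENNReal.ofReal (Real.exp (Y i ω)) ∂P ≤ ENNReal.ofReal (Real.exp 1))
    (lam : ℝ) :
    P {ω | (1 + lam) * ∑ i ∈ I, w i < ∑ i ∈ I, w i * Y i ω}
      ≤ ENNReal.ofReal (Real.exp (-lam)) := by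
  set W := ∑ i ∈ I, w i with hW
  have hW0 : 0 ≤ W := Finset.sum_nonneg hw
  rcases hW0.eq_or_lt with h0 | hpos
  · have hzero : ∀ i ∈ I, w i = 0 := (Finset.sum_eq_zero_iff_of_nonneg hw).1 h0.symm
    have : {ω | (1 + lam) * W < ∑ i ∈ I, w i * Y i ω} = ∅ := by
      ext ω
      simp only [Set.mem_ofPred_eq, Set.mem_empty_iff_false, iff_false, not_lt]
      rw [← h0, mul_zero, Finset.sum_eq_zero fun i hi => by rw [hzero i hi, zero_mul]]
    rw [this]
    simp
  · have hmeas : Measurable fun ω => ∑ i ∈ I, w i / W * Y i ω :=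
      Finset.measurable_sum _ fun i hi => (hY i hi).const_mul _
    have hsum : ∑ i ∈ I, w i / W = 1 := by rw [← Finset.sum_div, ← hW, div_self hpos.ne']
    have hbound : ∫⁻ ω, ENNReal.ofReal (Real.exp (∑ i ∈ I, w i / W * Y i ω)) ∂P
        ≤ ENNReal.ofReal (Real.exp 1) := by
      calc _ ≤ ∫⁻ ω, ∑ i ∈ I, ENNReal.ofReal (w i / W) * ENNReal.ofReal (Real.exp (Y i ω)) ∂P := by
            refine lintegral_mono fun ω => ?_
            have h := convexOn_exp.map_sum_le (t := I) (w := fun i => w i / W)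
              (p := fun i => Y i ω) (fun i hi => div_nonneg (hw i hi) hW0) hsum
              (fun i _ => Set.mem_univ _)
            simp only [smul_eq_mul] at h
            refine (ENNReal.ofReal_le_ofReal h).trans (le_of_eq ?_)
            rw [ENNReal.ofReal_sum_of_nonneg fun i hi =>
              mul_nonneg (div_nonneg (hw i hi) hW0) (Real.exp_pos _).le]
            exact Finset.sum_congr rfl fun i hi => ENNReal.ofReal_mul (div_nonneg (hw i hi) hW0)
        _ = ∑ i ∈ I, ENNReal.ofReal (w i / W) * ∫⁻ ω, ENNReal.ofReal (Real.exp (Y i ω)) ∂P := by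
            rw [lintegral_finsetSum' _ fun i hi =>
              ((hY i hi).exp.ennreal_ofReal.const_mul _).aemeasurable]
            exact Finset.sum_congr rfl fun i hi =>
              lintegral_const_mul _ (hY i hi).exp.ennreal_ofReal
        _ ≤ ∑ i ∈ I, ENNReal.ofReal (w i / W) * ENNReal.ofReal (Real.exp 1) :=
            Finset.sum_le_sum fun i hi => mul_le_mul_right (hexp i hi) _
        _ = _ := by
            rw [← Finset.sum_mul, ← ENNReal.ofReal_sum_of_nonneg fun i hi =>
              div_nonneg (hw i hi) hW0, hsum, ENNReal.ofReal_one, one_mul]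
    have h1 := measure_le_of_lintegral_exp_le (b := 1 + lam) hmeas hbound
    rw [show (1 : ℝ) - (1 + lam) = -lam by ring] at h1
    refine (measure_mono fun ω hω => ?_).trans h1
    have h2 : ∑ i ∈ I, w i / W * Y i ω = (∑ i ∈ I, w i * Y i ω) / W := by
      rw [Finset.sum_div]
      exact Finset.sum_congr rfl fun i _ => by ring
    change 1 + lam ≤ ∑ i ∈ I, w i / W * Y i ω
    rw [h2, le_div_iff₀ hpos]
    exact le_of_lt hω

end Tails

/-! ### The filtration of the samples. -/

section Past

variable {Ω Ξ : Type*} [mΞ : MeasurableSpace Ξ]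

/-- The σ-algebra generated by the samples with index less than `n`. -/
abbrev past (ξ : ℕ → Ω → Ξ) (n : ℕ) : MeasurableSpace Ω :=
  ⨆ j ∈ Set.Iio n, MeasurableSpace.comap (ξ j) mΞ

theorem past_mono (ξ : ℕ → Ω → Ξ) : Monotone (past ξ) := fun _ _ h =>
  biSup_mono fun _ hj => lt_of_lt_of_le hj h

theorem past_le [mΩ : MeasurableSpace Ω] {ξ : ℕ → Ω → Ξ} (hξ : ∀ i, Measurable (ξ i)) (n : ℕ) : past ξ n ≤ mΩ :=
  iSup₂_le fun j _ => (hξ j).comap_le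

theorem measurable_past {ξ : ℕ → Ω → Ξ} {j n : ℕ} (h : j < n) : Measurable[past ξ n] (ξ j) :=
  measurable_iff_comap_le.2 (le_iSup₂_of_le j h le_rfl)

theorem indepFun_of_measurable_past [MeasurableSpace Ω] {P : Measure Ω} {ξ : ℕ → Ω → Ξ} (hξ : ∀ i, Measurable (ξ i))
    (hi : iIndepFun ξ P) {H : Type*} [MeasurableSpace H] {n : ℕ} {h : Ω → H}
    (hh : Measurable[past ξ n] h) : IndepFun h (ξ n) P := by
  have h1 := indep_iSup_of_disjoint (fun j => (hξ j).comap_le) hi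
    (S := Set.Iio n) (T := {n}) (by simp)
  rw [iSup_singleton] at h1
  exact (IndepFun_iff_Indep _ _ _).2 (indep_of_indep_of_le_left h1 hh.comap_le)

end Past

/-! ### Attainment and measurability of the gap function. -/

section Gap

variable {E F : Type*} [NormedAddCommGroup E] [NormedSpace ℝ E]
  [NormedAddCommGroup F] [NormedSpace ℝ F]

/-- On a bounded set the functionals are uniformly Lipschitz in `s`, hence so is their minimum, even
where the minimizer jumps. -/
theorem exists_continuous_min_value {C : Set E} (hC : IsCompact C) (hne : C.Nonempty) {φ : E → ℝ}
    (hφ : LowerSemicontinuousOn φ C) :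
    ∃ μ : StrongDual ℝ E → ℝ, Continuous μ ∧
      ∀ s, ∃ w ∈ C, μ s = φ w + s w ∧ ∀ v ∈ C, μ s ≤ φ v + s v := by
  have hex : ∀ s : StrongDual ℝ E, ∃ w ∈ C, IsMinOn (fun v => φ v + s v) C w := fun s =>
    LowerSemicontinuousOn.exists_isMinOn hne hC
      (hφ.add s.continuous.continuousOn.lowerSemicontinuousOn)
  choose a haC hamin using hex
  obtain ⟨R, hR⟩ := hC.isBounded.exists_norm_le
  have hR0 : 0 ≤ R := (norm_nonneg _).trans (hR _ hne.choose_spec)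
  refine ⟨fun s => φ (a s) + s (a s), ?_, fun s => ⟨a s, haC s, rfl, fun v hv => hamin s hv⟩⟩
  refine (LipschitzWith.of_le_add_mul R.toNNReal fun s r => ?_).continuous
  have h1 : φ (a s) + s (a s) ≤ φ (a r) + s (a r) := hamin s (haC r)
  have h2 : (s - r) (a r) ≤ ‖s - r‖ * ‖a r‖ := (le_abs_self _).trans ((s - r).le_opNorm _)
  have h3 := mul_le_mul_of_nonneg_left (hR _ (haC r)) (norm_nonneg (s - r))
  rw [Real.coe_toNNReal _ hR0, dist_eq_norm]
  simp only [sub_apply] at h2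
  linarith

variable {X : Set E} {Y : Set F} {G : E → ℝ} {J : F → ℝ}

/-- Q(z', ·) is a function of x plus a function of y, so its maximum is minus two separate minima.
Apart from G and J the gap is thus continuous in z', which makes it measurable along the iterates
although `J` is only lower semicontinuous. -/
theorem exists_isGreatest_saddleQ (hX : IsCompact X) (hXne : X.Nonempty) (hY : IsCompact Y)
    (hYne : Y.Nonempty) (hG : ContinuousOn G X) (K : E →L[ℝ] StrongDual ℝ F)
    (hJ : LowerSemicontinuousOn J Y) :
    ∃ c : E × F → ℝ, Continuous c ∧ ∀ z',
      IsGreatest (saddleQ G K J z' '' (X ×ˢ Y)) (G z'.1 + J z'.2 + c z') := by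
  obtain ⟨μX, hμX, hX'⟩ := exists_continuous_min_value hX hXne hG.lowerSemicontinuousOn
  obtain ⟨μY, hμY, hY'⟩ := exists_continuous_min_value hY hYne hJ
  refine ⟨fun z' => -μY (-(K z'.1)) - μX (K.flip z'.2), ?_, fun z' => ⟨?_, ?_⟩⟩
  · exact (hμY.comp (K.continuous.comp continuous_fst).neg).neg.sub
      (hμX.comp (K.flip.continuous.comp continuous_snd))
  · obtain ⟨x, hx, hx1, -⟩ := hX' (K.flip z'.2)
    obtain ⟨y, hy, hy1, -⟩ := hY' (-(K z'.1))
    refine ⟨(x, y), ⟨hx, hy⟩, ?_⟩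
    change _ = G z'.1 + J z'.2 + (-μY (-(K z'.1)) - μX (K.flip z'.2))
    rw [hx1, hy1]
    simp only [saddleQ, neg_apply, ContinuousLinearMap.flip_apply]
    ring
  · rintro _ ⟨⟨x, y⟩, ⟨hx, hy⟩, rfl⟩
    obtain ⟨_, _, _, h1⟩ := hX' (K.flip z'.2)
    obtain ⟨_, _, _, h2⟩ := hY' (-(K z'.1))
    have h1 := h1 x hx
    have h2 := h2 y hy
    simp only [neg_apply, ContinuousLinearMap.flip_apply] at h1 h2
    simp only [saddleQ]
    linarith

theorem isGreatest_gap (hX : IsCompact X) (hXne : X.Nonempty) (hY : IsCompact Y)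
    (hYne : Y.Nonempty) (hG : ContinuousOn G X) (K : E →L[ℝ] StrongDual ℝ F)
    (hJ : LowerSemicontinuousOn J Y) (z' : E × F) :
    IsGreatest (saddleQ G K J z' '' (X ×ˢ Y)) (gap X Y G K J z') := by
  obtain ⟨c, -, hc⟩ := exists_isGreatest_saddleQ hX hXne hY hYne hG K hJ
  rw [gap, (hc z').csSup_eq]
  exact hc z'

variable {Ω : Type*} [MeasurableSpace Ω]

theorem measurable_comp_of_domRestrict {α : Type*} [MeasurableSpace α] {C : Set α} {f : α → ℝ}
    (hf : Measurable (C.domRestrict f)) {u : Ω → α} (hu : Measurable u) (huC : ∀ ω, u ω ∈ C) :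
    Measurable fun ω => f (u ω) :=
  hf.comp (hu.subtype_mk (h := huC))

variable [FiniteDimensional ℝ E] [MeasurableSpace E] [BorelSpace E]
  [FiniteDimensional ℝ F] [MeasurableSpace F] [BorelSpace F]

theorem measurable_gap_comp (hX : IsCompact X) (hXne : X.Nonempty) (hY : IsCompact Y)
    (hYne : Y.Nonempty) (hG : ContinuousOn G X) (K : E →L[ℝ] StrongDual ℝ F)
    (hJ : LowerSemicontinuousOn J Y) {u : Ω → E} {v : Ω → F} (hu : Measurable u)
    (hv : Measurable v) (huX : ∀ ω, u ω ∈ X) (hvY : ∀ ω, v ω ∈ Y) :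
    Measurable fun ω => gap X Y G K J (u ω, v ω) := by
  have := FiniteDimensional.proper_real E
  have := FiniteDimensional.proper_real F
  obtain ⟨c, hc, hgr⟩ := exists_isGreatest_saddleQ hX hXne hY hYne hG K hJ
  have hgap : ∀ z', gap X Y G K J z' = G z'.1 + J z'.2 + c z' := fun z' => (hgr z').csSup_eq
  simp only [hgap]
  have h1 : Measurable (X.domRestrict G) :=
    (continuousOn_iff_continuous_domRestrict.1 hG).measurable
  have h2 : Measurable (Y.domRestrict J) := (lowerSemicontinuous_restrict_iff.2 hJ).measurable
  exact ((measurable_comp_of_domRestrict h1 hu huX).add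
    (measurable_comp_of_domRestrict h2 hv hvY)).add (hc.measurable.comp (hu.prodMk hv))

end Gap

/-! ### The bound for a single sample path. -/

section Pathwise

variable {E F Ξ : Type*} [NormedAddCommGroup E] [NormedSpace ℝ E] [MeasurableSpace E]
  [NormedAddCommGroup F] [NormedSpace ℝ F] [MeasurableSpace F] [MeasurableSpace Ξ]
  {O : StochasticOracle E F Ξ} {X : Set E} {Y : Set F} {G : E → ℝ} {J : F → ℝ}
  {dX : E → ℝ} {dY : F → ℝ} {β θ η τ : ℕ → ℝ} {x₁ : E} {y₁ : F} {s : ℕ → Ξ}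
  {x xbar xmd xag : ℕ → E} {y yag : ℕ → F}

theorem IsStochasticAPDRun.mem
    (h : IsStochasticAPDRun O X Y J dX dY β θ η τ x₁ y₁ s x xbar xmd xag y yag)
    (hX : Convex ℝ X) (hY : Convex ℝ Y) (hx₁ : x₁ ∈ X) (hy₁ : y₁ ∈ Y)
    (hβ : ∀ t, 1 ≤ t → 1 ≤ β t) {t : ℕ} (ht : 1 ≤ t) :
    x t ∈ X ∧ y t ∈ Y ∧ xag t ∈ X ∧ yag t ∈ Y ∧ xmd t ∈ X ∧ xbar t ∈ extrapolated X θ := by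
  have hx : ∀ t, 1 ≤ t → x t ∈ X := fun t ht => by
    rcases ht.eq_or_lt with rfl | h1
    · rwa [h.x_one]
    · obtain ⟨n, rfl⟩ := Nat.exists_eq_add_of_lt h1
      exact h.x_mem (1 + n) (by omega)
  have hy : ∀ t, 1 ≤ t → y t ∈ Y := fun t ht => by
    rcases ht.eq_or_lt with rfl | h1
    · rwa [h.y_one]
    · obtain ⟨n, rfl⟩ := Nat.exists_eq_add_of_lt h1
      exact h.y_mem (1 + n) (by omega)
  have hxag : ∀ t, 1 ≤ t → xag t ∈ X := fun t ht => by
    induction t, ht using Nat.le_induction with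
    | base => rwa [h.xag_one]
    | succ t ht ih =>
      rw [h.xag_eq t ht]
      exact convex_combination_mem hX (hβ t ht) ih (hx _ (by omega))
  have hyag : ∀ t, 1 ≤ t → yag t ∈ Y := fun t ht => by
    induction t, ht using Nat.le_induction with
    | base => rwa [h.yag_one]
    | succ t ht ih =>
      rw [h.yag_eq t ht]
      exact convex_combination_mem hY (hβ t ht) ih (hy _ (by omega))
  refine ⟨hx t ht, hy t ht, hxag t ht, hyag t ht, ?_, ?_⟩
  · rw [h.xmd_eq t ht]
    exact convex_combination_mem hX (hβ t ht) (hxag t ht) (hx t ht)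
  · rcases ht.eq_or_lt with rfl | h1
    -- The starting point is an extrapolated point with zero increment.
    · exact ⟨2, le_rfl, x₁, hx₁, x₁, hx₁, by simp [h.xbar_one]⟩
    · obtain ⟨n, rfl⟩ := Nat.exists_eq_add_of_lt h1
      exact ⟨1 + n + 1, by omega, _, hx (1 + n + 1) (by omega), _, hx (1 + n) (by omega),
        h.xbar_eq (1 + n) (by omega)⟩

/-- The shadow sequences of a run: `xv`, `yv` follow mirror steps along the errors `A`, `B` of the
primal and `e` of the dual gradient estimates, `xw` is the half step, and `xh` is the prox step
from the iterate `x t` along the first primal error. -/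
structure IsShadow (X : Set E) (Y : Set F) (dX : E → ℝ) (dY : F → ℝ) (η τ : ℕ → ℝ) (q : ℝ)
    (x₁ : E) (y₁ : F) (x : ℕ → E) (A B : ℕ → StrongDual ℝ E) (e : ℕ → StrongDual ℝ F)
    (xv xw xh : ℕ → E) (yv : ℕ → F) : Prop where
  xv_one : xv 1 = x₁
  yv_one : yv 1 = y₁
  xw_mem : ∀ t, 1 ≤ t → xw t ∈ X
  xw_argmin : ∀ t, 1 ≤ t → IsMinOn (fun v => (-A t) v + 1 / η t * bregman dX v (xv t)) X (xw t)
  xv_mem : ∀ t, 1 ≤ t → xv (t + 1) ∈ X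
  xv_argmin : ∀ t, 1 ≤ t →
    IsMinOn (fun v => (-B t) v + 1 / η t * bregman dX v (xw t)) X (xv (t + 1))
  xh_mem : ∀ t, 1 ≤ t → xh t ∈ X
  xh_argmin : ∀ t, 1 ≤ t →
    IsMinOn (fun v => A t v + (1 - q) * (1 / η t) * bregman dX v (x t)) X (xh t)
  yv_mem : ∀ t, 1 ≤ t → yv (t + 1) ∈ Y
  yv_argmin : ∀ t, 1 ≤ t →
    IsMinOn (fun v => e t v + 1 / τ t * bregman dY v (yv t)) Y (yv (t + 1))

variable {K : E →L[ℝ] StrongDual ℝ F} {A B : ℕ → StrongDual ℝ E} {e : ℕ → StrongDual ℝ F}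
  {xv xw xh : ℕ → E} {yv : ℕ → F} {p q αX αY : ℝ}

/-- The noise in iteration `t`. -/
noncomputable def noise (η τ : ℕ → ℝ) (p q αX αY : ℝ) (x : ℕ → E) (y : ℕ → F) (A B : ℕ → StrongDual ℝ E)
    (e : ℕ → StrongDual ℝ F) (xv xw xh : ℕ → E) (yv : ℕ → F) (t : ℕ) : ℝ :=
  (2 - q) * η t / (2 * ((1 - q) * αX)) * (‖A t‖ ^ 2 + ‖B t‖ ^ 2)
    + (2 - p) * τ t / (2 * ((1 - p) * αY)) * ‖e t‖ ^ 2
    + A t (xv t - x t) + B t (xw t - xh t) + e t (y t - yv t)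

/-- The primal step sees the new dual point and the dual step sees `xbar t`, so the bilinear terms
leave -K(x_{t+1} - x̄_t)(y_{t+1} - v), written here as two terms through x_t. -/
theorem IsStochasticAPDRun.one_step
    (h : IsStochasticAPDRun O X Y J dX dY β θ η τ x₁ y₁ s x xbar xmd xag y yag)
    (hs : IsShadow X Y dX dY η τ q x₁ y₁ x A B e xv xw xh yv)
    (hA : ∀ t, 1 ≤ t → O.estG (xmd t) (s (2 * t - 1)) = fderiv ℝ G (xmd t) + A t)
    (hB : ∀ t, 1 ≤ t → O.estKy (y (t + 1)) (s (2 * t)) = K.flip (y (t + 1)) + B t)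
    (he : ∀ t, 1 ≤ t → O.estKx (xbar t) (s (2 * t - 1)) = K (xbar t) + e t)
    {LG : ℝ} (hG : IsSmoothConvex X LG G) (hJ : ConvexOn ℝ Y J)
    (hdX : IsDistanceGenerating X αX dX) (hdY : IsDistanceGenerating Y αY dY)
    (hp : p ∈ Set.Ioo (0 : ℝ) 1) (hq : q ∈ Set.Ioo (0 : ℝ) 1)
    (hη : ∀ t, 1 ≤ t → 0 < η t) (hτ : ∀ t, 1 ≤ t → 0 < τ t)
    (hx₁ : x₁ ∈ X) (hy₁ : y₁ ∈ Y)
    (hβ : ∀ t, 1 ≤ t → 1 ≤ β t) {u : E} {v : F} (hu : u ∈ X) (hv : v ∈ Y) {t : ℕ} (ht : 1 ≤ t) :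
    β t * saddleQ G K J (xag (t + 1), yag (t + 1)) (u, v)
        - (β t - 1) * saddleQ G K J (xag t, yag t) (u, v)
      ≤ 1 / η t * (bregman dX u (x t) + bregman dX u (xv t)
            - (bregman dX u (x (t + 1)) + bregman dX u (xv (t + 1))))
        + 1 / τ t * (bregman dY v (y t) + bregman dY v (yv t)
            - (bregman dY v (y (t + 1)) + bregman dY v (yv (t + 1))))
        - K (x (t + 1) - x t) (y (t + 1) - v) + K (xbar t - x t) (y (t + 1) - v)
        - (q * αX / η t - LG / β t) / 2 * ‖x (t + 1) - x t‖ ^ 2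
        - p * αY / (2 * τ t) * ‖y (t + 1) - y t‖ ^ 2
        + noise η τ p q αX αY x y A B e xv xw xh yv t := by
  obtain ⟨hxt, hyt, hxat, hyat, -, -⟩ := h.mem hdX.convex hdY.convex hx₁ hy₁ hβ ht
  have hxt1 := h.x_mem t ht
  have hyt1 := h.y_mem t ht
  have hxvt : xv t ∈ X := by
    rcases ht.eq_or_lt with rfl | h1
    · rwa [hs.xv_one]
    · obtain ⟨n, rfl⟩ := Nat.exists_eq_add_of_lt h1
      exact hs.xv_mem (1 + n) (by omega)
  have hyvt : yv t ∈ Y := by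
    rcases ht.eq_or_lt with rfl | h1
    · rwa [hs.yv_one]
    · obtain ⟨n, rfl⟩ := Nat.exists_eq_add_of_lt h1
      exact hs.yv_mem (1 + n) (by omega)
  have hηt := hη t ht
  have hτt := hτ t ht
  have hβt : 0 < β t := zero_lt_one.trans_le (hβ t ht)
  have h1 := saddleQ_average_le hG K hJ (hβ t ht) hxt hxt1 hxat hu hyt1 hyat (y := v)
  rw [← h.xag_eq t ht, ← h.yag_eq t ht, ← h.xmd_eq t ht] at h1
  have hxmin := h.x_argmin t ht
  have hymin := h.y_argmin t ht
  rw [hA t ht, hB t ht] at hxmin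
  rw [he t ht] at hymin
  have h2 := hdX.linear_prox_step_le (fderiv ℝ G (xmd t) + K.flip (y (t + 1))) (A t) (B t)
    (one_div_pos.2 hηt) hq hxt hxt1 (hs.xh_mem t ht) hxvt (hs.xw_mem t ht) (hs.xv_mem t ht) hu
    (by
      convert hxmin using 2
      simp only [add_apply]
      ring)
    (hs.xh_argmin t ht) (hs.xw_argmin t ht) (hs.xv_argmin t ht)
  have h3 := hdY.composite_prox_step_le hJ (-(K (xbar t))) (-(e t)) (one_div_pos.2 hτt) hp hyt
    hyt1 hyvt (hs.yv_mem t ht) hv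
    (by
      convert hymin using 2
      simp only [add_apply, neg_apply]
      ring)
    (by simpa only [neg_neg] using hs.yv_argmin t ht)
  have e1 : q * (1 / η t) * αX / 2 = q * αX / η t / 2 := by ring
  have e2 : p * (1 / τ t) * αY / 2 = p * αY / (2 * τ t) := by
    field_simp
  have e3 : (2 - q) / (2 * ((1 - q) * (1 / η t) * αX)) = (2 - q) * η t / (2 * ((1 - q) * αX)) := by
    field_simp
  have e4 : (2 - p) / (2 * ((1 - p) * (1 / τ t) * αY)) = (2 - p) * τ t / (2 * ((1 - p) * αY)) := by
    field_simp
  have e5 : LG / (2 * β t) = LG / β t / 2 := by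
    field_simp
  rw [e1, e3] at h2
  rw [e2, e4, norm_neg] at h3
  rw [e5] at h1
  unfold noise
  simp only [map_sub, add_apply, neg_apply, sub_apply, ContinuousLinearMap.flip_apply] at *
  linarith

theorem IsStochasticAPDRun.saddleQ_le
    (h : IsStochasticAPDRun O X Y J dX dY β θ η τ x₁ y₁ s x xbar xmd xag y yag)
    (hs : IsShadow X Y dX dY η τ q x₁ y₁ x A B e xv xw xh yv)
    (hA : ∀ t, 1 ≤ t → O.estG (xmd t) (s (2 * t - 1)) = fderiv ℝ G (xmd t) + A t)
    (hB : ∀ t, 1 ≤ t → O.estKy (y (t + 1)) (s (2 * t)) = K.flip (y (t + 1)) + B t)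
    (he : ∀ t, 1 ≤ t → O.estKx (xbar t) (s (2 * t - 1)) = K (xbar t) + e t)
    {LG : ℝ} (hG : IsSmoothConvex X LG G) (hJ : ConvexOn ℝ Y J)
    (hdX : IsDistanceGenerating X αX dX) (hdY : IsDistanceGenerating Y αY dY) {ΩX ΩY : ℝ}
    (hVX : ∀ x₁ ∈ X, ∀ x₂ ∈ X, bregman dX x₁ x₂ ≤ ΩX ^ 2)
    (hVY : ∀ y₁ ∈ Y, ∀ y₂ ∈ Y, bregman dY y₁ y₂ ≤ ΩY ^ 2)
    (hp : p ∈ Set.Ioo (0 : ℝ) 1) (hq : q ∈ Set.Ioo (0 : ℝ) 1)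
    (hη : ∀ t, 1 ≤ t → 0 < η t) (hτ : ∀ t, 1 ≤ t → 0 < τ t)
    (hβ_one : β 1 = 1) (hβ : ∀ t, 1 ≤ t → β (t + 1) - 1 = β t * θ (t + 1))
    (hθ : ∀ t, 2 ≤ t → 0 < θ t ∧ θ t ≤ min (η (t - 1) / η t) (τ (t - 1) / τ t))
    (hstep : ∀ t, 1 ≤ t → 0 ≤ q * αX / η t - LG / β t - ‖K‖ ^ 2 * τ t / (p * αY))
    (hx₁ : x₁ ∈ X) (hy₁ : y₁ ∈ Y)
    {u : E} {v : F} (hu : u ∈ X) (hv : v ∈ Y) {t : ℕ} (ht : 1 ≤ t) :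
    β t * gammaSeq θ t * saddleQ G K J (xag (t + 1), yag (t + 1)) (u, v)
      ≤ gammaSeq θ t / η t * (2 * ΩX ^ 2) + gammaSeq θ t / τ t * (2 * ΩY ^ 2)
        + ∑ i ∈ Finset.Icc 1 t, gammaSeq θ i * noise η τ p q αX αY x y A B e xv xw xh yv i := by
  have hβ1 : ∀ t, 1 ≤ t → 1 ≤ β t := fun t ht =>
    one_le_of_recursion hβ_one hβ (fun t ht => (hθ t ht).1) ht
  have hone := fun t (ht : 1 ≤ t) =>
    h.one_step hs hA hB he hG hJ hdX hdY hp hq hη hτ hx₁ hy₁ hβ1 hu hv ht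
  have hx : ∀ t, 1 ≤ t → x t ∈ X := fun t ht => (h.mem hdX.convex hdY.convex hx₁ hy₁ hβ1 ht).1
  have hy : ∀ t, 1 ≤ t → y t ∈ Y := fun t ht => (h.mem hdX.convex hdY.convex hx₁ hy₁ hβ1 ht).2.1
  have hxv : ∀ t, 1 ≤ t → xv t ∈ X := fun t ht => by
    rcases ht.eq_or_lt with rfl | h1
    · rwa [hs.xv_one]
    · obtain ⟨n, rfl⟩ := Nat.exists_eq_add_of_lt h1
      exact hs.xv_mem (1 + n) (by omega)
  have hyv : ∀ t, 1 ≤ t → yv t ∈ Y := fun t ht => by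
    rcases ht.eq_or_lt with rfl | h1
    · rwa [hs.yv_one]
    · obtain ⟨n, rfl⟩ := Nat.exists_eq_add_of_lt h1
      exact hs.yv_mem (1 + n) (by omega)
  have hbilin : ∀ a b, K a b ≤ ‖K‖ * ‖a‖ * ‖b‖ := fun a b =>
    (le_abs_self _).trans (K.le_opNorm₂ a b)
  refine weighted_telescope (LG := LG) (LK := ‖K‖) hp hdY.1 hη hτ hβ hθ hstep
    (fun t => saddleQ G K J (xag t, yag t) (u, v))
    (fun t => bregman dX u (x t) + bregman dX u (xv t))
    (fun t => bregman dY v (y t) + bregman dY v (yv t))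
    (fun t => K (x (t + 1) - x t) (y (t + 1) - v))
    (fun t => ‖x (t + 1) - x t‖) (fun t => ‖y (t + 1) - y t‖) _
    (fun t => ‖v - y (t + 1)‖) ?_ ?_ ?_ ?_ ?_ ?_ ht
  · intro t ht
    have h1 := hdX.bregman_nonneg (hx t ht) hu
    have h2 := hdX.bregman_nonneg (hxv t ht) hu
    have h3 := hVX _ hu _ (hx t ht)
    have h4 := hVX _ hu _ (hxv t ht)
    exact ⟨by linarith, by linarith⟩
  · intro t ht
    have h1 := hdY.bregman_nonneg (hy t ht) hv
    have h2 := hdY.bregman_nonneg (hyv t ht) hv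
    have h3 := hVY _ hv _ (hy t ht)
    have h4 := hVY _ hv _ (hyv t ht)
    exact ⟨by linarith, by linarith⟩
  · intro t ht
    have h1 := hdY.le_bregman (hy (t + 1) (by omega)) hv
    have h2 := hdY.bregman_nonneg (hyv (t + 1) (by omega)) hv
    linarith
  · intro t ht
    have h1 := hbilin (x (t + 1) - x t) (v - y (t + 1))
    simp only [map_sub] at h1 ⊢
    linarith
  · have h1 := hone 1 le_rfl
    rw [h.xbar_one, h.x_one] at h1
    rw [hβ_one] at h1 ⊢
    simp only [sub_self, map_zero, zero_apply, zero_mul] at h1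
    simp only [h.x_one] at *
    linarith
  · intro t ht
    have h1 := hone (t + 1) (by omega)
    have h2 := hbilin (x (t + 1) - x t) (y (t + 1 + 1) - y (t + 1))
    have h3 := mul_le_mul_of_nonneg_left h2 (hθ (t + 1) (by omega)).1.le
    -- Splitting the second slot at y_{t+1} gives the bilinear term of the previous iteration, which
    -- telescopes, and a product of increments.
    have h4 : K (xbar (t + 1) - x (t + 1)) (y (t + 1 + 1) - v)
        = θ (t + 1) * K (x (t + 1) - x t) (y (t + 1) - v)
          + θ (t + 1) * K (x (t + 1) - x t) (y (t + 1 + 1) - y (t + 1)) := by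
      rw [h.xbar_eq t ht, add_sub_cancel_right, map_smul, smul_apply, smul_eq_mul, ← mul_add,
        ← map_add]
      congr 2
      abel
    rw [h4] at h1
    change _ ≤ 1 / η (t + 1) * _ + 1 / τ (t + 1) * _ - _ + _ + _ - _ - _ + _
    linarith

end Pathwise

/-! ### Construction and adaptedness of the shadow sequences. -/

section Shadow

theorem measurable_uncurry_comp {Ω V Ξ W : Type*} {m : MeasurableSpace Ω} [MeasurableSpace V]
    [MeasurableSpace Ξ] [MeasurableSpace W] {Z : V → Ξ → W}
    (hZ : Measurable (Function.uncurry Z)) {a : Ω → V} {b : Ω → Ξ} (ha : Measurable a)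
    (hb : Measurable b) : Measurable fun ω => Z (a ω) (b ω) :=
  hZ.comp (ha.prodMk hb)

theorem IsDistanceGenerating.exists_measurable_linear_prox {E : Type*} [NormedAddCommGroup E]
    [NormedSpace ℝ E] [FiniteDimensional ℝ E] [MeasurableSpace E] [BorelSpace E] {X : Set E}
    {α : ℝ} {d : E → ℝ} (hd : IsDistanceGenerating X α d) (hX : IsCompact X) (hne : X.Nonempty)
    {b : ℝ} (hb : 0 < b) :
    ∃ pr : StrongDual ℝ E × E → E, Measurable pr ∧ ∀ s u, pr (s, u) ∈ X ∧
      IsMinOn (fun v => s v + b * bregman d v u) X (pr (s, u)) ∧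
      ∀ w ∈ X, IsMinOn (fun v => s v + b * bregman d v u) X w → w = pr (s, u) := by
  simpa only [zero_add] using hd.exists_measurable_prox hX hne (convexOn_const 0 hd.convex)
    (lowerSemicontinuousOn_const (z := 0)) hb

variable {E F Ξ Ω : Type*} [NormedAddCommGroup E] [NormedSpace ℝ E] [FiniteDimensional ℝ E]
  [MeasurableSpace E] [BorelSpace E] [NormedAddCommGroup F] [NormedSpace ℝ F]
  [FiniteDimensional ℝ F] [MeasurableSpace F] [BorelSpace F] [MeasurableSpace Ξ]
  {O : StochasticOracle E F Ξ} {X : Set E} {Y : Set F} {G : E → ℝ} {J : F → ℝ}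
  {K : E →L[ℝ] StrongDual ℝ F} {dX : E → ℝ} {dY : F → ℝ} {αX αY q : ℝ} {β θ η τ : ℕ → ℝ}
  {x₁ : E} {y₁ : F} {ξ : ℕ → Ω → Ξ} {x xbar xmd xag : ℕ → Ω → E} {y yag : ℕ → Ω → F}

/-- The shadow sequences exist, and all sequences are adapted to the samples. -/
theorem exists_adapted_shadow (hX : IsCompact X) (hY : IsCompact Y) (hJconvex : ConvexOn ℝ Y J)
    (hJlsc : LowerSemicontinuousOn J Y)
    (hdX : IsDistanceGenerating X αX dX) (hdY : IsDistanceGenerating Y αY dY)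
    (hq : q ∈ Set.Ioo (0 : ℝ) 1) (hη : ∀ t, 1 ≤ t → 0 < η t) (hτ : ∀ t, 1 ≤ t → 0 < τ t)
    (hx₁ : x₁ ∈ X) (hy₁ : y₁ ∈ Y)
    (hrun : ∀ ω, IsStochasticAPDRun O X Y J dX dY β θ η τ x₁ y₁ (fun i => ξ i ω)
      (fun t => x t ω) (fun t => xbar t ω) (fun t => xmd t ω) (fun t => xag t ω)
      (fun t => y t ω) (fun t => yag t ω)) :
    ∃ (xv xw xh : ℕ → Ω → E) (yv : ℕ → Ω → F),
      (∀ ω, IsShadow X Y dX dY η τ q x₁ y₁ (fun t => x t ω)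
        (fun t => O.estG (xmd t ω) (ξ (2 * t - 1) ω) - fderiv ℝ G (xmd t ω))
        (fun t => O.estKy (y (t + 1) ω) (ξ (2 * t) ω) - K.flip (y (t + 1) ω))
        (fun t => O.estKx (xbar t ω) (ξ (2 * t - 1) ω) - K (xbar t ω))
        (fun t => xv t ω) (fun t => xw t ω) (fun t => xh t ω) (fun t => yv t ω)) ∧
      ∀ t, 1 ≤ t →
        (Measurable[past ξ (2 * t - 1)] (x t) ∧ Measurable[past ξ (2 * t - 1)] (y t) ∧
          Measurable[past ξ (2 * t - 1)] (xbar t) ∧ Measurable[past ξ (2 * t - 1)] (xag t) ∧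
          Measurable[past ξ (2 * t - 1)] (yag t) ∧ Measurable[past ξ (2 * t - 1)] (xv t) ∧
          Measurable[past ξ (2 * t - 1)] (yv t)) ∧
        Measurable[past ξ (2 * t - 1)] (xmd t) ∧
        Measurable[past ξ (2 * t)] (y (t + 1)) ∧ Measurable[past ξ (2 * t)] (xw t) ∧
          Measurable[past ξ (2 * t)] (xh t) := by
  have := FiniteDimensional.proper_real E
  have := FiniteDimensional.proper_real F
  have := secondCountable_strongDual (E := E)
  have := secondCountable_strongDual (E := F)
  have hXne : X.Nonempty := ⟨x₁, hx₁⟩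
  have hYne : Y.Nonempty := ⟨y₁, hy₁⟩
  have hq1 : 0 < 1 - q := by linarith [hq.2]
  choose prX hprXm hprX using fun (b : {b : ℝ // 0 < b}) =>
    hdX.exists_measurable_linear_prox hX hXne b.2
  choose prY hprYm hprY using fun (b : {b : ℝ // 0 < b}) =>
    hdY.exists_measurable_linear_prox hY hYne b.2
  choose prJ hprJm hprJ using fun (b : {b : ℝ // 0 < b}) =>
    hdY.exists_measurable_prox hY hYne hJconvex hJlsc b.2
  set A : ℕ → Ω → StrongDual ℝ E := fun t ω =>
    O.estG (xmd t ω) (ξ (2 * t - 1) ω) - fderiv ℝ G (xmd t ω) with hA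
  set B : ℕ → Ω → StrongDual ℝ E := fun t ω =>
    O.estKy (y (t + 1) ω) (ξ (2 * t) ω) - K.flip (y (t + 1) ω) with hB
  set e : ℕ → Ω → StrongDual ℝ F := fun t ω =>
    O.estKx (xbar t ω) (ξ (2 * t - 1) ω) - K (xbar t ω) with he
  -- The prox coefficients must be positive for every index; the value 1 at index 0 plays no role.
  let bη : ℕ → {b : ℝ // 0 < b} := fun t =>
    if h : 1 ≤ t then ⟨1 / η t, one_div_pos.2 (hη t h)⟩ else ⟨1, one_pos⟩
  let bτ : ℕ → {b : ℝ // 0 < b} := fun t =>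
    if h : 1 ≤ t then ⟨1 / τ t, one_div_pos.2 (hτ t h)⟩ else ⟨1, one_pos⟩
  have hbη : ∀ t, 1 ≤ t → ((bη t : {b : ℝ // 0 < b}) : ℝ) = 1 / η t := fun t h => by
    simp only [bη, dif_pos h]
  have hbτ : ∀ t, 1 ≤ t → ((bτ t : {b : ℝ // 0 < b}) : ℝ) = 1 / τ t := fun t h => by
    simp only [bτ, dif_pos h]
  -- The recursion starts at index 1: the values at 0 and 1 are both `x₁`. A step makes the mirror
  -- step for the first error and then that for the second.
  let xv : ℕ → Ω → E := fun n => Nat.rec (fun _ => x₁) (fun n prev =>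
    if n = 0 then fun _ => x₁
    else fun ω => prX (bη n) (-B n ω, prX (bη n) (-A n ω, prev ω))) n
  let yv : ℕ → Ω → F := fun n => Nat.rec (fun _ => y₁) (fun n prev =>
    if n = 0 then fun _ => y₁ else fun ω => prY (bτ n) (e n ω, prev ω)) n
  let xw : ℕ → Ω → E := fun n ω => prX (bη n) (-A n ω, xv n ω)
  let xh : ℕ → Ω → E := fun n ω => prX ⟨(1 - q) * bη n, mul_pos hq1 (bη n).2⟩ (A n ω, x n ω)
  have hxv : ∀ t, 1 ≤ t → xv (t + 1) = fun ω => prX (bη t) (-B t ω, xw t ω) := fun t ht =>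
    if_neg (by omega)
  have hyv : ∀ t, 1 ≤ t → yv (t + 1) = fun ω => prY (bτ t) (e t ω, yv t ω) := fun t ht =>
    if_neg (by omega)
  refine ⟨xv, xw, xh, yv, fun ω => ⟨rfl, rfl, fun t ht => (hprX _ _ _).1, fun t ht => ?_,
    fun t ht => ?_, fun t ht => ?_, fun t ht => (hprX _ _ _).1, fun t ht => ?_, fun t ht => ?_,
    fun t ht => ?_⟩, ?_⟩
  · have := (hprX (bη t) (-A t ω) (xv t ω)).2.1
    rwa [hbη t ht] at this
  · simp only [hxv t ht]
    exact (hprX _ _ _).1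
  · have := (hprX (bη t) (-B t ω) (xw t ω)).2.1
    rw [hbη t ht] at this
    simp only [hxv t ht]
    exact this
  · have := (hprX ⟨(1 - q) * bη t, mul_pos hq1 (bη t).2⟩ (A t ω) (x t ω)).2.1
    simp only [hbη t ht] at this
    simpa only [xh, hbη t ht] using this
  · simp only [hyv t ht]
    exact (hprY _ _ _).1
  · have := (hprY (bτ t) (e t ω) (yv t ω)).2.1
    rw [hbτ t ht] at this
    simp only [hyv t ht]
    exact this
  -- adaptedness
  have hxmd : ∀ t, 1 ≤ t → ∀ {m : MeasurableSpace Ω}, Measurable[m] (x t) →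
      Measurable[m] (xag t) → Measurable[m] (xmd t) := by
    intro t ht m h1 h2
    have : xmd t = fun ω => (1 - (β t)⁻¹) • xag t ω + (β t)⁻¹ • x t ω :=
      funext fun ω => (hrun ω).xmd_eq t ht
    rw [this]
    exact (h2.const_smul _).add (h1.const_smul _)
  have hhalf : ∀ t, 1 ≤ t → Measurable[past ξ (2 * t - 1)] (x t) →
      Measurable[past ξ (2 * t - 1)] (y t) → Measurable[past ξ (2 * t - 1)] (xbar t) →
      Measurable[past ξ (2 * t - 1)] (xag t) → Measurable[past ξ (2 * t - 1)] (xv t) →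
      Measurable[past ξ (2 * t)] (y (t + 1)) ∧ Measurable[past ξ (2 * t)] (xw t) ∧
        Measurable[past ξ (2 * t)] (xh t) := by
    intro t ht hx hy hxb hxa hxvm
    have hle : past ξ (2 * t - 1) ≤ past ξ (2 * t) := past_mono ξ (by omega)
    have hξ : Measurable[past ξ (2 * t)] (ξ (2 * t - 1)) := measurable_past (by omega)
    have hmd := (hxmd t ht hx hxa).mono hle le_rfl
    have hAm : Measurable[past ξ (2 * t)] (A t) :=
      (measurable_uncurry_comp O.measurable_estG hmd hξ).sub ((measurable_fderiv ℝ G).comp hmd)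
    refine ⟨?_, ?_, ?_⟩
    · have : y (t + 1) = fun ω => prJ (bτ t) (-O.estKx (xbar t ω) (ξ (2 * t - 1) ω), y t ω) := by
        funext ω
        -- The run only provides some minimizer; uniqueness identifies it with the measurable prox
        -- map.
        refine (hprJ (bτ t) _ _).2.2 _ ((hrun ω).y_mem t ht) ?_
        rw [hbτ t ht]
        convert (hrun ω).y_argmin t ht using 2
        simp only [neg_apply]
        ring
      rw [this]
      exact (hprJm _).comp (((measurable_uncurry_comp O.measurable_estKx (hxb.mono hle le_rfl) hξ).neg).prodMk
        (hy.mono hle le_rfl))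
    · exact (hprXm _).comp (hAm.neg.prodMk (hxvm.mono hle le_rfl))
    · exact (hprXm _).comp (hAm.prodMk (hx.mono hle le_rfl))
  have hmain : ∀ t, 1 ≤ t → (Measurable[past ξ (2 * t - 1)] (x t) ∧
      Measurable[past ξ (2 * t - 1)] (y t) ∧
      Measurable[past ξ (2 * t - 1)] (xbar t) ∧ Measurable[past ξ (2 * t - 1)] (xag t) ∧
      Measurable[past ξ (2 * t - 1)] (yag t) ∧ Measurable[past ξ (2 * t - 1)] (xv t) ∧
      Measurable[past ξ (2 * t - 1)] (yv t)) := by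
    intro t ht
    induction t, ht using Nat.le_induction with
    | base =>
      have e1 : x 1 = fun _ => x₁ := funext fun ω => (hrun ω).x_one
      have e2 : y 1 = fun _ => y₁ := funext fun ω => (hrun ω).y_one
      have e3 : xbar 1 = fun _ => x₁ := funext fun ω => (hrun ω).xbar_one
      have e4 : xag 1 = fun _ => x₁ := funext fun ω => (hrun ω).xag_one
      have e5 : yag 1 = fun _ => y₁ := funext fun ω => (hrun ω).yag_one
      rw [e1, e2, e3, e4, e5]
      exact ⟨measurable_const, measurable_const, measurable_const, measurable_const,
        measurable_const, measurable_const, measurable_const⟩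
    | succ t ht ih =>
      obtain ⟨hx, hy, hxb, hxa, hya, hxvm, hyvm⟩ := ih
      obtain ⟨hy', hxw', -⟩ := hhalf t ht hx hy hxb hxa hxvm
      rw [show 2 * (t + 1) - 1 = 2 * t + 1 by omega]
      have hle1 : past ξ (2 * t - 1) ≤ past ξ (2 * t + 1) := past_mono ξ (by omega)
      have hle2 : past ξ (2 * t) ≤ past ξ (2 * t + 1) := past_mono ξ (by omega)
      have hξ1 : Measurable[past ξ (2 * t + 1)] (ξ (2 * t - 1)) := measurable_past (by omega)
      have hξ2 : Measurable[past ξ (2 * t + 1)] (ξ (2 * t)) := measurable_past (by omega)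
      replace hmd := (hxmd t ht hx hxa).mono hle1 le_rfl
      replace hx := hx.mono hle1 le_rfl
      replace hxb := hxb.mono hle1 le_rfl
      replace hxa := hxa.mono hle1 le_rfl
      replace hya := hya.mono hle1 le_rfl
      replace hyvm := hyvm.mono hle1 le_rfl
      replace hy' := hy'.mono hle2 le_rfl
      replace hxw' := hxw'.mono hle2 le_rfl
      have hx' : Measurable[past ξ (2 * t + 1)] (x (t + 1)) := by
        have : x (t + 1) = fun ω => prX (bη t) (O.estG (xmd t ω) (ξ (2 * t - 1) ω)
            + O.estKy (y (t + 1) ω) (ξ (2 * t) ω), x t ω) := by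
          funext ω
          refine (hprX (bη t) _ _).2.2 _ ((hrun ω).x_mem t ht) ?_
          rw [hbη t ht]
          exact (hrun ω).x_argmin t ht
        rw [this]
        exact (hprXm _).comp (((measurable_uncurry_comp O.measurable_estG hmd hξ1).add
          (measurable_uncurry_comp O.measurable_estKy hy' hξ2)).prodMk hx)
      have e3 : xbar (t + 1) = fun ω => θ (t + 1) • (x (t + 1) ω - x t ω) + x (t + 1) ω :=
        funext fun ω => (hrun ω).xbar_eq t ht
      have e4 : xag (t + 1) = fun ω => (1 - (β t)⁻¹) • xag t ω + (β t)⁻¹ • x (t + 1) ω :=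
        funext fun ω => (hrun ω).xag_eq t ht
      have e5 : yag (t + 1) = fun ω => (1 - (β t)⁻¹) • yag t ω + (β t)⁻¹ • y (t + 1) ω :=
        funext fun ω => (hrun ω).yag_eq t ht
      rw [e3, e4, e5, hxv t ht, hyv t ht]
      have hBm : Measurable[past ξ (2 * t + 1)] (B t) :=
        (measurable_uncurry_comp O.measurable_estKy hy' hξ2).sub (K.flip.continuous.measurable.comp hy')
      have hem : Measurable[past ξ (2 * t + 1)] (e t) :=
        (measurable_uncurry_comp O.measurable_estKx hxb hξ1).sub (K.continuous.measurable.comp hxb)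
      exact ⟨hx', hy', ((hx'.sub hx).const_smul _).add hx',
        (hxa.const_smul _).add (hx'.const_smul _), (hya.const_smul _).add (hy'.const_smul _),
        (hprXm _).comp (hBm.neg.prodMk hxw'), (hprYm _).comp (hem.prodMk hyvm)⟩
  intro t ht
  obtain ⟨hx, hy, hxb, hxa, hya, hxvm, hyvm⟩ := hmain t ht
  exact ⟨hmain t ht, hxmd t ht hx hxa, hhalf t ht hx hy hxb hxa hxvm⟩

end Shadow

/-! ### Tail bounds for the accumulated oracle errors. -/

section ErrorSums

variable {Ω Ξ V U : Type*} {mΩ : MeasurableSpace Ω} [MeasurableSpace Ξ] [MeasurableSpace V]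
  [NormedAddCommGroup U] [NormedSpace ℝ U] [FiniteDimensional ℝ U]
  {P : Measure Ω} [IsProbabilityMeasure P] {Z : V → Ξ → StrongDual ℝ U}
  {m : V → StrongDual ℝ U} {S : Set V} {σ : ℝ} {ν : Measure Ξ} {ξ : ℕ → Ω → Ξ} {k : ℕ → ℕ}
  {v : ℕ → Ω → V}

/-- `k i` is the index of the sample drawn for the `i`-th error. Point and direction depend on
earlier samples only, so the summands are conditionally sub-Gaussian increments. -/
theorem measure_error_apply_sum_gt_le [MeasurableSpace U] [BorelSpace U]
    (hξ : ∀ i, Measurable (ξ i)) (hlaw : ∀ i, P.map (ξ i) = ν)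
    (hindep : iIndepFun ξ P) (hk : Monotone k) (hklt : ∀ i, 1 ≤ i → k i < k (i + 1))
    (hZ : Measurable (Function.uncurry Z)) (hm : Measurable m)
    (hmean : ∀ x ∈ S, HasMean ν (Z x) (m x)) (htail : ∀ x ∈ S, HasLightTail ν (Z x) (m x) σ)
    (hv : ∀ i, 1 ≤ i → Measurable[past ξ (k i)] (v i)) (hvS : ∀ i, 1 ≤ i → ∀ ω, v i ω ∈ S)
    {u : ℕ → Ω → U} (hu : ∀ i, 1 ≤ i → Measurable[past ξ (k i)] (u i)) {D : ℝ}
    (huD : ∀ i, 1 ≤ i → ∀ ω, ‖u i ω‖ ≤ D) (c : ℕ → ℝ) (t : ℕ) {lam : ℝ} (hlam : 0 < lam) :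
    P {ω | lam * Real.sqrt (∑ i ∈ Finset.Icc 1 t, (c i * (D * σ)) ^ 2)
        < ∑ i ∈ Finset.Icc 1 t, c i * (Z (v i ω) (ξ (k i) ω) - m (v i ω)) (u i ω)}
      ≤ ENNReal.ofReal (Real.exp (-lam ^ 2 / 3)) := by
  have := secondCountable_strongDual (E := U)
  refine measure_sum_gt_le (m := fun i => past ξ (k i)) (fun i => past_le hξ _)
    (fun a b hab => past_mono ξ (hk hab)) (fun i hi => ?_) (fun i hi r w hw => ?_) t hlam
  · have hle := past_mono ξ (hklt i hi).le
    have hv' := (hv i hi).mono hle le_rfl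
    exact (measurable_dual_apply.comp (((measurable_uncurry_comp hZ hv'
      (measurable_past (hklt i hi))).sub (hm.comp hv')).prodMk
        ((hu i hi).mono hle le_rfl))).const_mul (c i)
  · have hmeas : Measurable[past ξ (k i)] fun ω => (w ω, v i ω, u i ω) :=
      hw.prodMk ((hv i hi).prodMk (hu i hi))
    have h := HasLightTail.lintegral_mul_exp_le hZ hm (hmeas.mono (past_le hξ _) le_rfl)
      (hξ (k i)) (indepFun_of_measurable_past hξ hindep hmeas) (hvS i hi) (huD i hi)
      (by rwa [hlaw]) (by rwa [hlaw]) (r * c i)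
    simpa only [mul_assoc] using h

theorem measure_error_sq_sum_gt_le
    (hξ : ∀ i, Measurable (ξ i)) (hlaw : ∀ i, P.map (ξ i) = ν) (hindep : iIndepFun ξ P)
    (hZ : Measurable (Function.uncurry Z)) (hm : Measurable m)
    (htail : ∀ x ∈ S, HasLightTail ν (Z x) (m x) σ)
    (hv : ∀ i, 1 ≤ i → Measurable[past ξ (k i)] (v i)) (hvS : ∀ i, 1 ≤ i → ∀ ω, v i ω ∈ S)
    {c : ℕ → ℝ} (hc : ∀ i, 1 ≤ i → 0 ≤ c i) (t : ℕ) (lam : ℝ) :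
    P {ω | (1 + lam) * ∑ i ∈ Finset.Icc 1 t, c i * σ ^ 2
        < ∑ i ∈ Finset.Icc 1 t, c i * ‖Z (v i ω) (ξ (k i) ω) - m (v i ω)‖ ^ 2}
      ≤ ENNReal.ofReal (Real.exp (-lam)) := by
  have h := fun i (hi : 1 ≤ i) => HasLightTail.lintegral_exp_error_le hZ hm
    ((hv i hi).mono (past_le hξ _) le_rfl) (hξ (k i))
    (indepFun_of_measurable_past hξ hindep (hv i hi)) (hvS i hi) (by rwa [hlaw] : ∀ x ∈ S,
      HasLightTail (P.map (ξ (k i))) (Z x) (m x) σ)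
  have h1 := measure_weighted_sum_gt_le (P := P) (Finset.Icc 1 t) (w := fun i => c i * σ ^ 2)
    (Y := fun i ω => ‖Z (v i ω) (ξ (k i) ω) - m (v i ω)‖ ^ 2 / σ ^ 2)
    (fun i hi => mul_nonneg (hc i (Finset.mem_Icc.1 hi).1) (sq_nonneg σ))
    (fun i hi => (((measurable_estimator_error hZ hm).comp
      (((hv i (Finset.mem_Icc.1 hi).1).mono (past_le hξ _) le_rfl).prodMk
        (hξ (k i)))).norm.pow_const 2).div_const _)
    (fun i hi => (h i (Finset.mem_Icc.1 hi).1).1) lam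
  refine (measure_mono_ae ?_).trans h1
  -- Normalizing by σ² is harmless also for `σ = 0`, since the error then vanishes almost surely.
  have hae : ∀ᵐ ω ∂P, ∀ i ∈ Finset.Icc 1 t, c i * ‖Z (v i ω) (ξ (k i) ω) - m (v i ω)‖ ^ 2
      = c i * σ ^ 2 * (‖Z (v i ω) (ξ (k i) ω) - m (v i ω)‖ ^ 2 / σ ^ 2) := by
    rw [Finset.eventually_all]
    intro i hi
    by_cases hσ : σ = 0
    · filter_upwards [(h i (Finset.mem_Icc.1 hi).1).2 hσ] with ω hω
      simp [hω]
    · refine Filter.Eventually.of_forall fun ω => ?_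
      field_simp
  filter_upwards [hae] with ω hω hmem
  change _ < _ at hmem
  rw [Finset.sum_congr rfl hω] at hmem
  exact hmem

end ErrorSums

/-! ### Rewriting of the constants. -/

section Constants

variable {β θ η τ : ℕ → ℝ} {p q αX αY : ℝ}

theorem mul_varianceSum (σx σy : ℝ) {t : ℕ} (h : β t * gammaSeq θ t ≠ 0) :
    β t * gammaSeq θ t * varianceSum β θ η τ p q αX αY σx σy t
      = ∑ i ∈ Finset.Icc 1 t, gammaSeq θ i * ((2 - q) * η i / (2 * ((1 - q) * αX))) * σx ^ 2
        + ∑ i ∈ Finset.Icc 1 t, gammaSeq θ i * ((2 - p) * τ i / (2 * ((1 - p) * αY))) * σy ^ 2 := by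
  rw [varianceSum, ← mul_assoc, ← Finset.sum_add_distrib]
  have e : β t * gammaSeq θ t * (1 / (2 * β t * gammaSeq θ t)) = 1 / 2 := by
    rw [mul_assoc 2, one_div, mul_inv, mul_left_comm, mul_inv_cancel₀ h]
    norm_num
  rw [e, Finset.mul_sum]
  refine Finset.sum_congr rfl fun i _ => ?_
  rw [← div_div _ 2, ← div_div _ 2]
  ring

theorem mul_boundQ0 (ΩX ΩY σx σy : ℝ) {t : ℕ} (h : β t * gammaSeq θ t ≠ 0) :
    β t * gammaSeq θ t * boundQ0 β θ η τ p q αX αY ΩX ΩY σx σy t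
      = gammaSeq θ t / η t * (2 * ΩX ^ 2) + gammaSeq θ t / τ t * (2 * ΩY ^ 2)
        + β t * gammaSeq θ t * varianceSum β θ η τ p q αX αY σx σy t := by
  rw [boundQ0, mul_add, ← mul_assoc, mul_one_div_cancel h]
  ring

theorem mul_boundQ1 (ΩX ΩY σx σy : ℝ) {t : ℕ} (h : β t * gammaSeq θ t ≠ 0) :
    β t * gammaSeq θ t * boundQ1 β θ η τ p q αX αY ΩX ΩY σx σy t
      = (Real.sqrt 2 * σx * ΩX / Real.sqrt αX + σy * ΩY / Real.sqrt αY)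
          * Real.sqrt (2 * ∑ i ∈ Finset.Icc 1 t, gammaSeq θ i ^ 2)
        + β t * gammaSeq θ t * varianceSum β θ η τ p q αX αY σx σy t := by
  rw [boundQ1, mul_add, ← mul_assoc, ← mul_assoc, mul_one_div_cancel h, one_mul]

theorem sqrt_sum_sq_mul (c : ℕ → ℝ) {R α σ : ℝ} (hR : 0 ≤ R) (hα : 0 < α) (hσ : 0 ≤ σ) (t : ℕ) :
    Real.sqrt (∑ i ∈ Finset.Icc 1 t, (c i * (R * Real.sqrt (2 / α) * σ)) ^ 2)
      = σ * R / Real.sqrt α * Real.sqrt (2 * ∑ i ∈ Finset.Icc 1 t, c i ^ 2) := by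
  simp only [mul_pow (c _)]
  rw [← Finset.sum_mul, Real.sqrt_mul (Finset.sum_nonneg fun i _ => sq_nonneg _),
    Real.sqrt_sq (by positivity), Real.sqrt_mul zero_le_two, Real.sqrt_div zero_le_two]
  ring

theorem add_le_sqrt_two_mul_sqrt (a b : ℝ) :
    a + b ≤ Real.sqrt 2 * Real.sqrt (a ^ 2 + b ^ 2) := by
  rw [← Real.sqrt_mul zero_le_two]
  exact Real.le_sqrt_of_sq_le (by nlinarith [sq_nonneg (a - b)])

end Constants

/-! ### The theorem. -/

theorem theorem3p1
    {E F Ξ Ω : Type*}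
    [NormedAddCommGroup E] [NormedSpace ℝ E] [FiniteDimensional ℝ E]
    [MeasurableSpace E] [BorelSpace E]
    [NormedAddCommGroup F] [NormedSpace ℝ F] [FiniteDimensional ℝ F]
    [MeasurableSpace F] [BorelSpace F]
    [MeasurableSpace Ξ] [MeasurableSpace Ω]
    -- the saddle point problem
    (X : Set E) (Y : Set F)
    (hXclosed : IsClosed X) (hXconvex : Convex ℝ X)
    (hYclosed : IsClosed Y) (hYconvex : Convex ℝ Y)
    (G : E → ℝ) (LG : ℝ) (hG : IsSmoothConvex X LG G)
    (K : E →L[ℝ] StrongDual ℝ F)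
    (J : F → ℝ) (hJconvex : ConvexOn ℝ Y J) (hJlsc : LowerSemicontinuousOn J Y)
    -- the Bregman divergences, bounded on `X` and on `Y`
    (dX : E → ℝ) (dY : F → ℝ) (αX αY : ℝ)
    (hdX : IsDistanceGenerating X αX dX) (hdY : IsDistanceGenerating Y αY dY)
    (ΩX ΩY : ℝ) (hΩX : 0 < ΩX) (hΩY : 0 < ΩY)
    (hVX : ∀ x₁ ∈ X, ∀ x₂ ∈ X, bregman dX x₁ x₂ ≤ ΩX ^ 2)
    (hVY : ∀ y₁ ∈ Y, ∀ y₂ ∈ Y, bregman dY y₁ y₂ ≤ ΩY ^ 2)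
    -- the parameters
    (β θ η τ : ℕ → ℝ) (p q : ℝ)
    (hp : p ∈ Set.Ioo (0 : ℝ) 1) (hq : q ∈ Set.Ioo (0 : ℝ) 1)
    (hη : ∀ t, 1 ≤ t → 0 < η t) (hτ : ∀ t, 1 ≤ t → 0 < τ t)
    (hβ_one : β 1 = 1) (hβ : ∀ t, 1 ≤ t → β (t + 1) - 1 = β t * θ (t + 1))
    (hθ : ∀ t, 2 ≤ t → 0 < θ t ∧ θ t ≤ min (η (t - 1) / η t) (τ (t - 1) / τ t))
    (hstep : ∀ t, 1 ≤ t →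
      0 ≤ q * αX / η t - LG / β t - ‖K‖ ^ 2 * τ t / (p * αY))
    -- the unbiased stochastic oracle and its independent, identically distributed samples
    (O : StochasticOracle E F Ξ) (ν : Measure Ξ) (hO : O.Unbiased ν X Y θ G K)
    (σxG σy σxK : ℝ) (hσxG : 0 ≤ σxG) (hσy : 0 ≤ σy) (hσxK : 0 ≤ σxK)
    (P : Measure Ω) [IsProbabilityMeasure P]
    (ξ : ℕ → Ω → Ξ) (hξ_meas : ∀ i, Measurable (ξ i)) (hξ_law : ∀ i, P.map (ξ i) = ν)
    (hξ_indep : iIndepFun ξ P)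
    -- the iterates
    (x₁ : E) (y₁ : F) (hx₁ : x₁ ∈ X) (hy₁ : y₁ ∈ Y)
    (x xbar xmd xag : ℕ → Ω → E) (y yag : ℕ → Ω → F)
    (hrun : ∀ ω, IsStochasticAPDRun O X Y J dX dY β θ η τ x₁ y₁ (fun i => ξ i ω)
      (fun t => x t ω) (fun t => xbar t ω) (fun t => xmd t ω) (fun t => xag t ω)
      (fun t => y t ω) (fun t => yag t ω)) :
    -- the maximum in the definition of the gap function is attained
    (∀ z' ∈ X ×ˢ Y, IsGreatest (saddleQ G K J z' '' (X ×ˢ Y)) (gap X Y G K J z')) ∧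
    -- (a)
    (O.BoundedVariance ν X Y θ G K σxG σy σxK →
      ∀ t, 1 ≤ t →
        Integrable (fun ω => gap X Y G K J (xag (t + 1) ω, yag (t + 1) ω)) P ∧
        ∫ ω, gap X Y G K J (xag (t + 1) ω, yag (t + 1) ω) ∂P
          ≤ boundQ0 β θ η τ p q αX αY ΩX ΩY (Real.sqrt (σxG ^ 2 + σxK ^ 2)) σy t) ∧
    -- (b)
    (O.LightTail ν X Y θ G K σxG σy σxK →
      ∀ lam : ℝ, 0 < lam → ∀ t, 1 ≤ t →
        P.real {ω | boundQ0 β θ η τ p q αX αY ΩX ΩY (Real.sqrt (σxG ^ 2 + σxK ^ 2)) σy t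
            + lam * boundQ1 β θ η τ p q αX αY ΩX ΩY (Real.sqrt (σxG ^ 2 + σxK ^ 2)) σy t
            < gap X Y G K J (xag (t + 1) ω, yag (t + 1) ω)}
          ≤ 3 * Real.exp (-lam ^ 2 / 3) + 3 * Real.exp (-lam)) := by
  have hXc : IsCompact X := hdX.isCompact hXclosed hΩX hVX
  have hYc : IsCompact Y := hdY.isCompact hYclosed hΩY hVY
  have hXne : X.Nonempty := ⟨x₁, hx₁⟩
  have hYne : Y.Nonempty := ⟨y₁, hy₁⟩
  have hGc : ContinuousOn G X := fun u hu => (hG.2.2.1 u hu).continuousAt.continuousWithinAt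
  have hgap := isGreatest_gap hXc hXne hYc hYne hGc K hJlsc
  refine ⟨fun z' _ => hgap z', ?_⟩
  have hαX := hdX.1
  have hαY := hdY.1
  have hp1 : 0 < 1 - p := by linarith [hp.2]
  have hq1 : 0 < 1 - q := by linarith [hq.2]
  have hp2 : 0 < 2 - p := by linarith [hp.2]
  have hq2 : 0 < 2 - q := by linarith [hq.2]
  have hθ0 : ∀ t, 2 ≤ t → 0 < θ t := fun t ht => (hθ t ht).1
  have hγ : ∀ t, 0 < gammaSeq θ t := gammaSeq_pos hθ0
  have hβ1 : ∀ t, 1 ≤ t → 1 ≤ β t := fun t ht => one_le_of_recursion hβ_one hβ hθ0 ht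
  obtain ⟨xv, xw, xh, yv, hshadow, hadapted⟩ :=
    exists_adapted_shadow (K := K) (G := G) hXc hYc hJconvex hJlsc hdX hdY hq hη hτ hx₁ hy₁ hrun
  have hmem := fun t (ht : 1 ≤ t) ω => (hrun ω).mem hXconvex hYconvex hx₁ hy₁ hβ1 ht
  -- the three error sequences
  set A : ℕ → Ω → StrongDual ℝ E := fun t ω =>
    O.estG (xmd t ω) (ξ (2 * t - 1) ω) - fderiv ℝ G (xmd t ω) with hA
  set B : ℕ → Ω → StrongDual ℝ E := fun t ω =>
    O.estKy (y (t + 1) ω) (ξ (2 * t) ω) - K.flip (y (t + 1) ω) with hB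
  set e : ℕ → Ω → StrongDual ℝ F := fun t ω =>
    O.estKx (xbar t ω) (ξ (2 * t - 1) ω) - K (xbar t ω) with he
  set N : ℕ → Ω → ℝ := fun t ω => noise η τ p q αX αY (fun t => x t ω) (fun t => y t ω)
    (fun t => A t ω) (fun t => B t ω) (fun t => e t ω) (fun t => xv t ω) (fun t => xw t ω)
    (fun t => xh t ω) (fun t => yv t ω) t with hN
  have hpath : ∀ t, 1 ≤ t → ∀ ω,
      β t * gammaSeq θ t * gap X Y G K J (xag (t + 1) ω, yag (t + 1) ω)
        ≤ gammaSeq θ t / η t * (2 * ΩX ^ 2) + gammaSeq θ t / τ t * (2 * ΩY ^ 2)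
          + ∑ i ∈ Finset.Icc 1 t, gammaSeq θ i * N i ω := by
    intro t ht ω
    -- The maximizer depends on `ω`, which is allowed because the pathwise bound holds for all `(u,
    -- v)` with the same noise.
    obtain ⟨⟨u, v⟩, ⟨hu, hv⟩, huv⟩ := (hgap (xag (t + 1) ω, yag (t + 1) ω)).1
    rw [← huv]
    exact (hrun ω).saddleQ_le (hshadow ω) (fun t _ => (add_sub_cancel _ _).symm)
      (fun t _ => (add_sub_cancel _ _).symm) (fun t _ => (add_sub_cancel _ _).symm) hG hJconvex
      hdX hdY hVX hVY hp hq hη hτ hβ_one hβ hθ hstep hx₁ hy₁ hu hv ht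
  have hxvX : ∀ t, 1 ≤ t → ∀ ω, xv t ω ∈ X := fun t ht ω => by
    rcases ht.eq_or_lt with rfl | h1
    · rw [(hshadow ω).xv_one]
      exact hx₁
    · obtain ⟨n, rfl⟩ := Nat.exists_eq_add_of_lt h1
      exact (hshadow ω).xv_mem (1 + n) (by omega)
  have hyvY : ∀ t, 1 ≤ t → ∀ ω, yv t ω ∈ Y := fun t ht ω => by
    rcases ht.eq_or_lt with rfl | h1
    · rw [(hshadow ω).yv_one]
      exact hy₁
    · obtain ⟨n, rfl⟩ := Nat.exists_eq_add_of_lt h1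
      exact (hshadow ω).yv_mem (1 + n) (by omega)
  -- points and directions of the three error sequences
  have hAv : ∀ t, 1 ≤ t → Measurable[past ξ (2 * t - 1)] (xmd t) := fun t ht =>
    (hadapted t ht).2.1
  have hAu : ∀ t, 1 ≤ t → Measurable[past ξ (2 * t - 1)] (fun ω => xv t ω - x t ω) := fun t ht =>
    have h := (hadapted t ht).1
    h.2.2.2.2.2.1.sub h.1
  have hAD : ∀ t, 1 ≤ t → ∀ ω, ‖xv t ω - x t ω‖ ≤ ΩX * Real.sqrt (2 / αX) := fun t ht ω =>
    hdX.norm_sub_le hΩX hVX (hxvX t ht ω) (hmem t ht ω).1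
  have hBv : ∀ t, 1 ≤ t → Measurable[past ξ (2 * t)] (y (t + 1)) := fun t ht =>
    (hadapted t ht).2.2.1
  have hBu : ∀ t, 1 ≤ t → Measurable[past ξ (2 * t)] (fun ω => xw t ω - xh t ω) := fun t ht =>
    have h := (hadapted t ht).2.2
    h.2.1.sub h.2.2
  have hBD : ∀ t, 1 ≤ t → ∀ ω, ‖xw t ω - xh t ω‖ ≤ ΩX * Real.sqrt (2 / αX) := fun t ht ω =>
    hdX.norm_sub_le hΩX hVX ((hshadow ω).xw_mem t ht) ((hshadow ω).xh_mem t ht)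
  have hev : ∀ t, 1 ≤ t → Measurable[past ξ (2 * t - 1)] (xbar t) := fun t ht =>
    (hadapted t ht).1.2.2.1
  have heu : ∀ t, 1 ≤ t → Measurable[past ξ (2 * t - 1)] (fun ω => y t ω - yv t ω) := fun t ht =>
    have h := (hadapted t ht).1
    h.2.1.sub h.2.2.2.2.2.2
  have heD : ∀ t, 1 ≤ t → ∀ ω, ‖y t ω - yv t ω‖ ≤ ΩY * Real.sqrt (2 / αY) := fun t ht ω =>
    hdY.norm_sub_le hΩY hVY (hmem t ht ω).2.1 (hyvY t ht ω)
  have hAS : ∀ t, 1 ≤ t → ∀ ω, xmd t ω ∈ X := fun t ht ω => (hmem t ht ω).2.2.2.2.1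
  have hBS : ∀ t, 1 ≤ t → ∀ ω, y (t + 1) ω ∈ Y := fun t ht ω => (hrun ω).y_mem t ht
  have heS : ∀ t, 1 ≤ t → ∀ ω, xbar t ω ∈ extrapolated X θ := fun t ht ω =>
    (hmem t ht ω).2.2.2.2.2
  have hmG : Measurable (fderiv ℝ G) := measurable_fderiv ℝ G
  have hmKy : Measurable K.flip := K.flip.continuous.measurable
  have hmKx : Measurable K := K.continuous.measurable
  set cX : ℕ → ℝ := fun i => (2 - q) * η i / (2 * ((1 - q) * αX)) with hcX
  set cY : ℕ → ℝ := fun i => (2 - p) * τ i / (2 * ((1 - p) * αY)) with hcY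
  have hcX0 : ∀ i, 1 ≤ i → 0 ≤ cX i := fun i hi => by
    have := hη i hi
    positivity
  have hcY0 : ∀ i, 1 ≤ i → 0 ≤ cY i := fun i hi => by
    have := hτ i hi
    positivity
  have hNeq : ∀ i ω, N i ω = cX i * (‖A i ω‖ ^ 2 + ‖B i ω‖ ^ 2) + cY i * ‖e i ω‖ ^ 2
      + A i ω (xv i ω - x i ω) + B i ω (xw i ω - xh i ω) + e i ω (y i ω - yv i ω) :=
    fun i ω => rfl
  have hσx : Real.sqrt (σxG ^ 2 + σxK ^ 2) ^ 2 = σxG ^ 2 + σxK ^ 2 :=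
    Real.sq_sqrt (by positivity)
  constructor
  · intro hvar t ht
    have hb : 0 < β t * gammaSeq θ t := mul_pos (zero_lt_one.trans_le (hβ1 t ht)) (hγ t)
    have hNint : ∀ i, 1 ≤ i → Integrable (N i) P ∧
        ∫ ω, N i ω ∂P ≤ cX i * (σxG ^ 2 + σxK ^ 2) + cY i * σy ^ 2 := by
      intro i hi
      have hle1 := past_le hξ_meas (2 * i - 1)
      have hle2 := past_le hξ_meas (2 * i)
      have hAi := integrable_error_sq (P := P) O.measurable_estG hmG ((hAv i hi).mono hle1 le_rfl)
        (hξ_meas (2 * i - 1)) (indepFun_of_measurable_past hξ_meas hξ_indep (hAv i hi)) (hAS i hi)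
        (by rw [hξ_law]; exact hvar.1)
      have hBi := integrable_error_sq (P := P) O.measurable_estKy hmKy
        ((hBv i hi).mono hle2 le_rfl) (hξ_meas (2 * i))
        (indepFun_of_measurable_past hξ_meas hξ_indep (hBv i hi)) (hBS i hi)
        (by rw [hξ_law]; exact hvar.2.2)
      have hei := integrable_error_sq (P := P) O.measurable_estKx hmKx
        ((hev i hi).mono hle1 le_rfl) (hξ_meas (2 * i - 1))
        (indepFun_of_measurable_past hξ_meas hξ_indep (hev i hi)) (heS i hi)
        (by rw [hξ_law]; exact hvar.2.1)
      have hAm := (hAv i hi).prodMk (hAu i hi)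
      have hBm := (hBv i hi).prodMk (hBu i hi)
      have hem := (hev i hi).prodMk (heu i hi)
      have hA0 := integral_error_apply_eq_zero (P := P) O.measurable_estG hmG
        (hAm.mono hle1 le_rfl) (hξ_meas (2 * i - 1))
        (indepFun_of_measurable_past hξ_meas hξ_indep hAm) (hAS i hi) (hAD i hi)
        (by rw [hξ_law]; exact hO.1) hAi.1
      have hB0 := integral_error_apply_eq_zero (P := P) O.measurable_estKy hmKy
        (hBm.mono hle2 le_rfl) (hξ_meas (2 * i))
        (indepFun_of_measurable_past hξ_meas hξ_indep hBm) (hBS i hi) (hBD i hi)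
        (by rw [hξ_law]; exact hO.2.2) hBi.1
      have he0 := integral_error_apply_eq_zero (P := P) O.measurable_estKx hmKx
        (hem.mono hle1 le_rfl) (hξ_meas (2 * i - 1))
        (indepFun_of_measurable_past hξ_meas hξ_indep hem) (heS i hi) (heD i hi)
        (by rw [hξ_law]; exact hO.2.1) hei.1
      have i1 : Integrable (fun ω => cX i * (‖A i ω‖ ^ 2 + ‖B i ω‖ ^ 2)) P :=
        (hAi.1.add hBi.1).const_mul _
      have i2 : Integrable (fun ω => cY i * ‖e i ω‖ ^ 2) P := hei.1.const_mul _
      have i12 : Integrable (fun ω => cX i * (‖A i ω‖ ^ 2 + ‖B i ω‖ ^ 2) + cY i * ‖e i ω‖ ^ 2) P :=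
        i1.add i2
      have i3 : Integrable (fun ω => cX i * (‖A i ω‖ ^ 2 + ‖B i ω‖ ^ 2) + cY i * ‖e i ω‖ ^ 2
          + A i ω (xv i ω - x i ω)) P := i12.add hA0.1
      have i4 : Integrable (fun ω => cX i * (‖A i ω‖ ^ 2 + ‖B i ω‖ ^ 2) + cY i * ‖e i ω‖ ^ 2
          + A i ω (xv i ω - x i ω) + B i ω (xw i ω - xh i ω)) P := i3.add hB0.1
      refine ⟨i4.add he0.1, ?_⟩
      simp only [hNeq]
      rw [integral_add i4 he0.1, integral_add i3 hB0.1, integral_add i12 hA0.1,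
        integral_add i1 i2, integral_const_mul, integral_const_mul, integral_add hAi.1 hBi.1]
      have h1 := mul_le_mul_of_nonneg_left (add_le_add hAi.2 hBi.2) (hcX0 i hi)
      have h2 := mul_le_mul_of_nonneg_left hei.2 (hcY0 i hi)
      have h3 := hA0.2
      have h4 := hB0.2
      have h5 := he0.2
      linarith
    set R : Ω → ℝ := fun ω => gammaSeq θ t / η t * (2 * ΩX ^ 2) + gammaSeq θ t / τ t * (2 * ΩY ^ 2)
      + ∑ i ∈ Finset.Icc 1 t, gammaSeq θ i * N i ω with hR
    have hsum : Integrable (fun ω => ∑ i ∈ Finset.Icc 1 t, gammaSeq θ i * N i ω) P :=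
      integrable_finsetSum _ fun i hi => (hNint i (Finset.mem_Icc.1 hi).1).1.const_mul _
    have hRint : Integrable R P := (integrable_const _).add hsum
    have hle : ∀ ω, gap X Y G K J (xag (t + 1) ω, yag (t + 1) ω)
        ≤ R ω / (β t * gammaSeq θ t) := fun ω => by
      rw [le_div_iff₀ hb, mul_comm]
      exact hpath t ht ω
    have hmem' := hmem (t + 1) (by omega)
    -- Since Q(z, z) = 0, the gap is nonnegative on X × Y, so an integrable upper bound suffices for
    -- integrability.
    have hnonneg : ∀ ω, 0 ≤ gap X Y G K J (xag (t + 1) ω, yag (t + 1) ω) := fun ω =>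
      (hgap _).2 ⟨(xag (t + 1) ω, yag (t + 1) ω), ⟨(hmem' ω).2.2.1, (hmem' ω).2.2.2.1⟩,
        by simp [saddleQ]⟩
    have hag := (hadapted (t + 1) (by omega)).1
    have hle' := past_le hξ_meas (2 * (t + 1) - 1)
    have hgm := measurable_gap_comp hXc hXne hYc hYne hGc K hJlsc
      (hag.2.2.2.1.mono hle' le_rfl) (hag.2.2.2.2.1.mono hle' le_rfl)
      (fun ω => (hmem' ω).2.2.1) (fun ω => (hmem' ω).2.2.2.1)
    have hgint : Integrable (fun ω => gap X Y G K J (xag (t + 1) ω, yag (t + 1) ω)) P := by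
      refine (hRint.div_const (β t * gammaSeq θ t)).mono hgm.aestronglyMeasurable
        (Filter.Eventually.of_forall fun ω => ?_)
      rw [Real.norm_of_nonneg (hnonneg ω)]
      exact (hle ω).trans (le_abs_self _)
    refine ⟨hgint, (integral_mono hgint (hRint.div_const _) hle).trans ?_⟩
    rw [integral_div, div_le_iff₀ hb, mul_comm _ (β t * gammaSeq θ t), mul_boundQ0 _ _ _ _ hb.ne',
      mul_varianceSum _ _ hb.ne', hσx, hR, integral_add (integrable_const _) hsum,
      integral_finsetSum _ fun i hi => (hNint i (Finset.mem_Icc.1 hi).1).1.const_mul _,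
      ← Finset.sum_add_distrib]
    simp only [integral_const, probReal_univ, smul_eq_mul, one_mul, integral_const_mul]
    gcongr with i hi
    have h1 := mul_le_mul_of_nonneg_left (hNint i (Finset.mem_Icc.1 hi).1).2 (hγ i).le
    simp only [hcX, hcY] at h1
    linarith
  · intro htail lam hlam t ht
    have hb : 0 < β t * gammaSeq θ t := mul_pos (zero_lt_one.trans_le (hβ1 t ht)) (hγ t)
    have hodd : Monotone fun i : ℕ => 2 * i - 1 := fun a b hab => by
      simp only
      omega
    have heven : Monotone fun i : ℕ => 2 * i := fun a b hab => by
      simp only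
      omega
    have tA := measure_error_apply_sum_gt_le (k := fun i => 2 * i - 1) hξ_meas hξ_law hξ_indep
      hodd (fun i hi => by omega) O.measurable_estG hmG hO.1 htail.1 hAv hAS hAu hAD
      (gammaSeq θ) t hlam
    have tB := measure_error_apply_sum_gt_le (k := fun i => 2 * i) hξ_meas hξ_law hξ_indep
      heven (fun i hi => by omega) O.measurable_estKy hmKy hO.2.2 htail.2.2 hBv hBS hBu
      hBD (gammaSeq θ) t hlam
    have te := measure_error_apply_sum_gt_le (k := fun i => 2 * i - 1) hξ_meas hξ_law hξ_indep
      hodd (fun i hi => by omega) O.measurable_estKx hmKx hO.2.1 htail.2.1 hev heS heu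
      heD (gammaSeq θ) t hlam
    rw [sqrt_sum_sq_mul _ hΩX.le hαX hσxG] at tA
    rw [sqrt_sum_sq_mul _ hΩX.le hαX hσxK] at tB
    rw [sqrt_sum_sq_mul _ hΩY.le hαY hσy] at te
    have sA := measure_error_sq_sum_gt_le (k := fun i => 2 * i - 1) hξ_meas hξ_law hξ_indep
      O.measurable_estG hmG htail.1 hAv hAS (c := fun i => gammaSeq θ i * cX i)
      (fun i hi => mul_nonneg (hγ i).le (hcX0 i hi)) t lam
    have sB := measure_error_sq_sum_gt_le (k := fun i => 2 * i) hξ_meas hξ_law hξ_indep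
      O.measurable_estKy hmKy htail.2.2 hBv hBS (c := fun i => gammaSeq θ i * cX i)
      (fun i hi => mul_nonneg (hγ i).le (hcX0 i hi)) t lam
    have se := measure_error_sq_sum_gt_le (k := fun i => 2 * i - 1) hξ_meas hξ_law hξ_indep
      O.measurable_estKx hmKx htail.2.1 hev heS (c := fun i => gammaSeq θ i * cY i)
      (fun i hi => mul_nonneg (hγ i).le (hcY0 i hi)) t lam
    set S := Real.sqrt (2 * ∑ i ∈ Finset.Icc 1 t, gammaSeq θ i ^ 2) with hS
    set EA := {ω | lam * (σxG * ΩX / Real.sqrt αX * S)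
      < ∑ i ∈ Finset.Icc 1 t, gammaSeq θ i * A i ω (xv i ω - x i ω)} with hEA
    set EB := {ω | lam * (σxK * ΩX / Real.sqrt αX * S)
      < ∑ i ∈ Finset.Icc 1 t, gammaSeq θ i * B i ω (xw i ω - xh i ω)} with hEB
    set Ee := {ω | lam * (σy * ΩY / Real.sqrt αY * S)
      < ∑ i ∈ Finset.Icc 1 t, gammaSeq θ i * e i ω (y i ω - yv i ω)} with hEe
    set FA := {ω | (1 + lam) * ∑ i ∈ Finset.Icc 1 t, gammaSeq θ i * cX i * σxG ^ 2
      < ∑ i ∈ Finset.Icc 1 t, gammaSeq θ i * cX i * ‖A i ω‖ ^ 2} with hFA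
    set FB := {ω | (1 + lam) * ∑ i ∈ Finset.Icc 1 t, gammaSeq θ i * cX i * σxK ^ 2
      < ∑ i ∈ Finset.Icc 1 t, gammaSeq θ i * cX i * ‖B i ω‖ ^ 2} with hFB
    set Fe := {ω | (1 + lam) * ∑ i ∈ Finset.Icc 1 t, gammaSeq θ i * cY i * σy ^ 2
      < ∑ i ∈ Finset.Icc 1 t, gammaSeq θ i * cY i * ‖e i ω‖ ^ 2} with hFe
    -- Outside six exceptional events the three pairing sums stay below the square-root part of λ
    -- Q₁, and the squared norms below 1 + λ times the variance sum, which occurs once in Q₀ and λ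
    -- times in λ Q₁.
    have hsub : {ω | boundQ0 β θ η τ p q αX αY ΩX ΩY (Real.sqrt (σxG ^ 2 + σxK ^ 2)) σy t
            + lam * boundQ1 β θ η τ p q αX αY ΩX ΩY (Real.sqrt (σxG ^ 2 + σxK ^ 2)) σy t
            < gap X Y G K J (xag (t + 1) ω, yag (t + 1) ω)}
        ⊆ ((EA ∪ EB) ∪ Ee) ∪ ((FA ∪ FB) ∪ Fe) := by
      intro ω hω
      by_contra hnot
      simp only [Set.mem_union, not_or, hEA, hEB, hEe, hFA, hFB, hFe, Set.mem_ofPred_eq,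
        not_lt] at hnot hω
      obtain ⟨⟨⟨h1, h2⟩, h3⟩, ⟨h4, h5⟩, h6⟩ := hnot
      have hlt := (mul_lt_mul_of_pos_left hω hb).trans_le (hpath t ht ω)
      rw [mul_add, mul_left_comm, mul_boundQ0 _ _ _ _ hb.ne', mul_boundQ1 _ _ _ _ hb.ne',
        mul_varianceSum _ _ hb.ne', hσx] at hlt
      have hsplit : ∑ i ∈ Finset.Icc 1 t, gammaSeq θ i * N i ω
          = ∑ i ∈ Finset.Icc 1 t, gammaSeq θ i * cX i * ‖A i ω‖ ^ 2
            + ∑ i ∈ Finset.Icc 1 t, gammaSeq θ i * cX i * ‖B i ω‖ ^ 2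
            + ∑ i ∈ Finset.Icc 1 t, gammaSeq θ i * cY i * ‖e i ω‖ ^ 2
            + ∑ i ∈ Finset.Icc 1 t, gammaSeq θ i * A i ω (xv i ω - x i ω)
            + ∑ i ∈ Finset.Icc 1 t, gammaSeq θ i * B i ω (xw i ω - xh i ω)
            + ∑ i ∈ Finset.Icc 1 t, gammaSeq θ i * e i ω (y i ω - yv i ω) := by
        simp only [← Finset.sum_add_distrib]
        refine Finset.sum_congr rfl fun i _ => ?_
        rw [hNeq]
        ring
      have hsplit2 : ∑ i ∈ Finset.Icc 1 t,
            gammaSeq θ i * ((2 - q) * η i / (2 * ((1 - q) * αX))) * (σxG ^ 2 + σxK ^ 2)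
          = ∑ i ∈ Finset.Icc 1 t, gammaSeq θ i * cX i * σxG ^ 2
            + ∑ i ∈ Finset.Icc 1 t, gammaSeq θ i * cX i * σxK ^ 2 := by
        rw [← Finset.sum_add_distrib]
        exact Finset.sum_congr rfl fun i _ => mul_add _ _ _
      rw [hsplit, hsplit2] at hlt
      -- The two primal pairing sums are bounded separately; σ_{x,G} + σ_{x,K} ≤ √2 σ_x is the
      -- origin of √2 in Q₁.
      have h7 : lam * (σxG * ΩX / Real.sqrt αX * S) + lam * (σxK * ΩX / Real.sqrt αX * S)
          ≤ lam * (Real.sqrt 2 * Real.sqrt (σxG ^ 2 + σxK ^ 2) * ΩX / Real.sqrt αX * S) := by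
        rw [← mul_add, ← add_mul, ← add_div, ← add_mul]
        have := add_le_sqrt_two_mul_sqrt σxG σxK
        gcongr
      linarith
    have hP : ∀ s : Set Ω, ∀ a : ℝ, P s ≤ ENNReal.ofReal (Real.exp a) → P.real s ≤ Real.exp a :=
      fun s a h => ENNReal.toReal_le_of_le_ofReal (Real.exp_pos a).le h
    have tA' := hP EA _ tA
    have tB' := hP EB _ tB
    have te' := hP Ee _ te
    have sA' := hP FA _ sA
    have sB' := hP FB _ sB
    have se' := hP Fe _ se
    have u1 := measureReal_union_le (μ := P) ((EA ∪ EB) ∪ Ee) ((FA ∪ FB) ∪ Fe)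
    have u2 := measureReal_union_le (μ := P) (EA ∪ EB) Ee
    have u3 := measureReal_union_le (μ := P) EA EB
    have u4 := measureReal_union_le (μ := P) (FA ∪ FB) Fe
    have u5 := measureReal_union_le (μ := P) FA FB
    have u0 := measureReal_mono (μ := P) hsub
    linarith
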